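/- Let $K$ be a field and let $E=(E^0,E^1,s,r)$ be an arbitrary directed graph. Let $L_K(E)$ be its Leavitt path algebra, with its canonical $\mathbb Z$-grading ($\mu\nu^*$ has degree $|\mu|-|\nu|$). Let $\partial E$ be the set of all infinite paths together with all finite paths ending at a sink or an infinite emitter. For $x,y\in\partial E$ and $k\in\mathbb Z$ write $x\sim_k y$ if $x=\mu p$, $y=\nu p$ for some finite paths $\mu,\nu$ and some $p\in\partial E$ with $|\mu|-|\nu|=k$. The graph groupoid is $\mathcal G_E=\{(x,k,y)\mid x\sim_k y\}$, with $(x,k,y)(y,l,z)=(x,k+l,z)$; an element $(x,k,y)$ has degree $k$. For $x\in\partial E$ let $L_x=\{(y,k,x)\in\mathcal G_E\}$, and let $(\mathcal G_E)_x=\{(x,k,x)\in\mathcal G_E\}$ be the isotropy group at $x$. The space $KL_x$ with basis $L_x$ is a graded right module over the graded group algebra $K(\mathcal G_E)_x$ by composition, and a graded left $L_K(E)$-module in which $\mu\nu^*$ sends $(\nu p,k,x)$ to $(\mu p,|\mu|-|\nu|+k,x)$ and all other elements of $L_x$ to $0$. For a graded $K(\mathcal G_E)_x$-module $N$ put $\operatorname{Ind}_x(N)=KL_x\otimes_{K(\mathcal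 G_E)_x}N$, a unital graded $L_K(E)$-module. A closed path has positive length; it is simple if it is not of the form $d^n$ with $d$ a closed path and $n\ge 2$. An infinite path is rational if it is tail-equivalent (that is, in relation $\sim_k$ for some $k$) to $c^\infty=ccc\cdots$ for some closed path $c$. For a simple closed path $c$ of length $n=|c|$, let $K[t^n,t^{-n}]\subseteq K[t,t^{-1}]$ be graded by powers of $t$ (the component of degree $j$ is $Kt^j$ if $n\mid j$ and $0$ otherwise), with $(c^\infty,kn,c^\infty)\in(\mathcal G_E)_{c^\infty}$ acting as multiplication by $t^{kn}$. For a graded module $M$ and $m\in\mathbb Z$ let $M(m)$ be the shifted module with $M(m)_j=M_{j+m}$. **Proposition.** Let $C$ be a set of simple closed paths in $E$ such that every simple closed path in $E$ is a rotation of exactly one element of $C$. Then the modules $$\operatorname{Ind}_{c^\infty}\bigl(K[t^{|c|},t^{-|c|}](m)\bigr),\qquad c\in C,\quad 0\le m\le |c|-1,$$ form a full list, up to graded isomorphism, of pairwise non-isomorphic graded simple $L_K(E)$-modules induced from isotropy groups of rational paths. That is: 1. each of these modules is a graded simple $L_K(E)$-module, induced from a graded module over the group algebra of the isotropy group of a rational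 path; 2. if two of these modules, with parameters $(c,m)$ and $(c',m')$, are graded isomorphic, then $c=c'$ and $m=m'$; 3. if $x$ is a rational path and $N$ is a graded $K(\mathcal G_E)_x$-module such that $\operatorname{Ind}_x(N)$ is a graded simple $L_K(E)$-module, then $\operatorname{Ind}_x(N)$ is graded isomorphic to one of these modules. -/

import Mathlib

open scoped TensorProduct LaurentPolynomial

noncomputable section

namespace LPA

/-! ## Directed graphs and paths -/

/-- A directed graph `E = (E⁰, E¹, s, r)` with vertex set `V` and edge set `W`, of arbitrary
cardinalities. -/
structure DirectedGraph (V W : Type*) where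
  /-- the source of an edge -/
  s : W → V
  /-- the range of an edge -/
  r : W → V

namespace DirectedGraph

variable {V W : Type*} (G : DirectedGraph V W)

/-- A vertex is singular if it is a sink or an infinite emitter. -/
def IsSingular (v : V) : Prop :=
  G.s ⁻¹' {v} = ∅ ∨ (G.s ⁻¹' {v}).Infinite

/-- `G.Composable v [e₁, …, eₙ]` says that `e₁ ⋯ eₙ` is a path that starts at the vertex `v`. -/
def Composable : V → List W → Prop
  | _, [] => True
  | v, e :: l => G.s e = v ∧ Composable (G.r e) l

/-- The vertex at which the path `e₁ ⋯ eₙ` starting at `v` ends. -/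
def target : V → List W → V
  | v, [] => v
  | _, e :: l => target (G.r e) l

variable {G}

lemma composable_append {v : V} {l l' : List W} :
    G.Composable v (l ++ l') ↔ G.Composable v l ∧ G.Composable (G.target v l) l' := by
  induction l generalizing v with
  | nil => simp [Composable, target]
  | cons e l ih => simp [Composable, target, ih, and_assoc]

lemma target_append {v : V} {l l' : List W} :
    G.target v (l ++ l') = G.target (G.target v l) l' := by
  induction l generalizing v with
  | nil => simp [target]
  | cons e l ih => simp [target, ih]

end DirectedGraph

variable {V W : Type*} {G : DirectedGraph V W}

/-- Finite paths, including the paths of length zero (the vertices). -/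
@[ext]
structure FinPath (G : DirectedGraph V W) where
  /-- the source of the path -/
  src : V
  /-- the edges of the path, in order -/
  edges : List W
  composable : G.Composable src edges

namespace FinPath

/-- The range of a finite path. -/
def range (μ : FinPath G) : V := G.target μ.src μ.edges

/-- The length of a finite path. -/
def length (μ : FinPath G) : ℕ := μ.edges.length

/-- A vertex, as a path of length zero. -/
def vertex (G : DirectedGraph V W) (v : V) : FinPath G := ⟨v, [], trivial⟩

/-- An edge, as a path of length one. -/
def edge (G : DirectedGraph V W) (e : W) : FinPath G := ⟨G.s e, [e], rfl, trivial⟩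

/-- Concatenation of finite paths. -/
def append (μ ν : FinPath G) (h : μ.range = ν.src) : FinPath G where
  src := μ.src
  edges := μ.edges ++ ν.edges
  composable := DirectedGraph.composable_append.2 ⟨μ.composable, by
    have := ν.composable
    rw [← h] at this
    exact this⟩

lemma append_range (μ ν : FinPath G) (h : μ.range = ν.src) :
    (μ.append ν h).range = ν.range := by
  unfold range at *
  simp only [append, DirectedGraph.target_append, h]

end FinPath

/-- Infinite paths `e₀ e₁ e₂ ⋯`. -/
@[ext]
structure InfPath (G : DirectedGraph V W) where
  /-- the sequence of edges -/
  edges : Stream' W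
  composable : ∀ n, G.r (edges.get n) = G.s (edges.get (n + 1))

/-- The source of an infinite path. -/
def InfPath.src (p : InfPath G) : V := G.s (p.edges.get 0)

lemma infComposable_append {v : V} {l : List W} {p : Stream' W}
    (hl : G.Composable v l) (hp : ∀ n, G.r (p.get n) = G.s (p.get (n + 1)))
    (h : G.target v l = G.s (p.get 0)) :
    G.s ((l ++ₛ p).get 0) = v ∧
      ∀ n, G.r ((l ++ₛ p).get n) = G.s ((l ++ₛ p).get (n + 1)) := by
  induction l generalizing v with
  | nil => exact ⟨h.symm, hp⟩
  | cons e l ih =>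
    obtain ⟨h1, h2⟩ := ih hl.2 h
    refine ⟨hl.1, ?_⟩
    intro n
    cases n with
    | zero => exact h1.symm
    | succ n => exact h2 n

/-- The boundary path space `∂E`: all infinite paths, and all finite paths whose range is a
singular vertex. -/
inductive BPath (G : DirectedGraph V W)
  | fin (μ : FinPath G) (h : G.IsSingular μ.range) : BPath G
  | inf (p : InfPath G) : BPath G

namespace BPath

/-- The source of a boundary path. -/
def src : BPath G → V
  | fin μ _ => μ.src
  | inf p => p.src

/-- The concatenation `μ p` of a finite path `μ` and a boundary path `p` with `r(μ) = s(p)`. -/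
def prepend (μ : FinPath G) : (p : BPath G) → μ.range = p.src → BPath G
  | fin ν hν, h => fin (μ.append ν h) ((FinPath.append_range μ ν h).symm ▸ hν)
  | inf p, h => inf
      { edges := μ.edges ++ₛ p.edges
        composable := (infComposable_append μ.composable p.composable h).2 }

lemma src_prepend (μ : FinPath G) (p : BPath G) (h : μ.range = p.src) :
    (prepend μ p h).src = μ.src := by
  cases p with
  | fin ν hν => rfl
  | inf p => exact (infComposable_append μ.composable p.composable h).1

lemma vertex_prepend (p : BPath G) (v : V) (h : (FinPath.vertex G v).range = p.src) :
    prepend (FinPath.vertex G v) p h = p := by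
  cases p with
  | fin ν hν =>
    have h' : v = ν.src := h
    subst h'
    rfl
  | inf p => rfl

lemma append_prepend (μ ν : FinPath G) (p : BPath G) (h : μ.range = ν.src)
    (hp : ν.range = p.src) :
    prepend (μ.append ν h) p ((FinPath.append_range μ ν h).trans hp) =
      prepend μ (prepend ν p hp) (h.trans (src_prepend ν p hp).symm) := by
  cases p with
  | fin ξ hξ => simp [prepend, FinPath.append]
  | inf p => simp [prepend, FinPath.append]

lemma prepend_injective {μ : FinPath G} {p q : BPath G} {hp : μ.range = p.src}
    {hq : μ.range = q.src} (h : prepend μ p hp = prepend μ q hq) : p = q := by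
  cases p with
  | fin ν hν =>
    cases q with
    | fin ξ hξ =>
      simp only [prepend, fin.injEq, FinPath.append, FinPath.mk.injEq, true_and,
        List.append_cancel_left_eq] at h
      have h2 : ν.src = ξ.src := hp.symm.trans hq
      have : ν = ξ := FinPath.ext h2 h
      subst this
      rfl
    | inf q => simp [prepend] at h
  | inf p =>
    cases q with
    | fin ξ hξ => simp [prepend] at h
    | inf q =>
      simp only [prepend, inf.injEq, InfPath.mk.injEq] at h
      have := Stream'.append_right_injective _ _ _ h
      rw [InfPath.ext this]

/-- If `μ p = ν q` with `|μ| ≤ |ν|`, then `ν = μ σ` and `p = σ q` for some finite path `σ`. -/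
lemma exists_of_prepend_eq {μ ν : FinPath G} {p q : BPath G} {hp : μ.range = p.src}
    {hq : ν.range = q.src} (h : prepend μ p hp = prepend ν q hq) (hl : μ.length ≤ ν.length) :
    ∃ (σ : FinPath G) (h1 : μ.range = σ.src) (h2 : σ.range = q.src),
      ν = μ.append σ h1 ∧ p = prepend σ q h2 := by
  have hs : μ.src = ν.src := by
    rw [← src_prepend μ p hp, h, src_prepend]
  have hpre : ∃ l, ν.edges = μ.edges ++ l := by
    cases p with
    | fin p' hp' =>
      cases q with
      | fin q' hq' =>
        simp only [prepend, fin.injEq, FinPath.append, FinPath.mk.injEq] at h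
        have := List.prefix_of_prefix_length_le (List.prefix_append μ.edges p'.edges)
          (h.2 ▸ List.prefix_append ν.edges q'.edges) hl
        obtain ⟨l, hl'⟩ := this
        exact ⟨l, hl'.symm⟩
      | inf q' => simp [prepend] at h
    | inf p' =>
      cases q with
      | fin q' hq' => simp [prepend] at h
      | inf q' =>
        simp only [prepend, inf.injEq, InfPath.mk.injEq] at h
        refine ⟨ν.edges.drop μ.edges.length, ?_⟩
        have h1 : (μ.edges ++ₛ p'.edges).take μ.edges.length = μ.edges := by
          have := Stream'.append_take 0 μ.edges p'.edges
          simpa using this.symm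
        have h2 : (ν.edges ++ₛ q'.edges).take μ.edges.length =
            ν.edges.take μ.edges.length :=
          Stream'.take_append_of_le_length (n := μ.edges.length) ν.edges q'.edges hl
        rw [h, h2] at h1
        conv_lhs => rw [← List.take_append_drop μ.edges.length ν.edges, h1]
  obtain ⟨l, hl'⟩ := hpre
  have hc := ν.composable
  rw [hl', ← hs, DirectedGraph.composable_append] at hc
  let σ : FinPath G := ⟨μ.range, l, hc.2⟩
  have hν : ν = μ.append σ rfl := FinPath.ext hs.symm hl'
  have hσ : σ.range = q.src := by
    rw [← hq, hν, FinPath.append_range]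
  refine ⟨σ, rfl, hσ, hν, ?_⟩
  subst hν
  rw [append_prepend μ σ q rfl hσ] at h
  exact prepend_injective h

end BPath

/-! ## Closed paths -/

/-- Closed paths (of positive length). -/
structure ClosedPath (G : DirectedGraph V W) extends FinPath G where
  ne_nil : edges ≠ []
  closed : G.target src edges = src

namespace ClosedPath

lemma cycle_drop (c : ClosedPath G) :
    (Stream'.cycle c.edges c.ne_nil).drop c.edges.length = Stream'.cycle c.edges c.ne_nil := by
  conv_lhs => rw [Stream'.cycle_eq, Stream'.drop_append_stream]

lemma head_eq_src (c : ClosedPath G) :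
    G.s ((Stream'.cycle c.edges c.ne_nil).get 0) = c.src := by
  have key : ∀ (l : List W) (p : Stream' W) (v : V), l ≠ [] → G.Composable v l →
      G.s ((l ++ₛ p).get 0) = v := by
    intro l p v h0 h1
    cases l with
    | nil => exact absurd rfl h0
    | cons e l => exact h1.1
  rw [Stream'.cycle_eq]
  exact key _ _ _ c.ne_nil c.composable

lemma cycle_composable_aux {p : Stream' W} : ∀ (l : List W) (v : V), G.Composable v l →
    G.target v l = G.s (p.get 0) → ∀ n, n < l.length →
      G.r ((l ++ₛ p).get n) = G.s ((l ++ₛ p).get (n + 1))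
  | [], _, _, _, n, hn => absurd hn (Nat.not_lt_zero n)
  | [_], _, _, h, 0, _ => h
  | _ :: _ :: _, _, hc, _, 0, _ => hc.2.1.symm
  | _ :: l, _, hc, h, n + 1, hn =>
    cycle_composable_aux l _ hc.2 h n (Nat.lt_of_succ_lt_succ hn)

/-- The infinite path `c^∞ = c c c ⋯`. -/
def infPow (c : ClosedPath G) : BPath G :=
  .inf
    { edges := Stream'.cycle c.edges c.ne_nil
      composable := by
        intro n
        induction n using Nat.strong_induction_on with
        | _ n ih =>
          by_cases hn : n < c.edges.length
          · have := cycle_composable_aux (p := Stream'.cycle c.edges c.ne_nil) c.edges c.src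
              c.composable (c.closed.trans c.head_eq_src.symm) n hn
            rwa [← Stream'.cycle_eq] at this
          · have hpos := List.length_pos_of_ne_nil c.ne_nil
            have := ih (n - c.edges.length) (by omega)
            rw [← c.cycle_drop, Stream'.get_drop, Stream'.get_drop] at this
            rwa [show c.edges.length + (n - c.edges.length) = n by omega,
              show c.edges.length + (n - c.edges.length + 1) = n + 1 by omega] at this }

end ClosedPath

/-- Simple closed paths: closed paths which are not of the form `dⁿ` for a closed path `d` and
an integer `n ≥ 2`. -/
structure SimpleClosedPath (G : DirectedGraph V W) extends ClosedPath G where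
  simple : ∀ (d : ClosedPath G) (n : ℕ), 2 ≤ n → edges ≠ (List.replicate n d.edges).flatten

/-- `c` and `d` are rotations of each other. (The source of a closed path is the source of its
first edge, so a rotation is determined by its edges.) -/
def SimpleClosedPath.IsRotation (c d : SimpleClosedPath G) : Prop :=
  c.edges.IsRotated d.edges

/-! ## Tail equivalence and the graph groupoid -/

/-- `x ∼ₖ y`: there are `μ, ν ∈ F(E)` and `p ∈ ∂E` with `r(μ) = r(ν) = s(p)` such that
`x = μ p`, `y = ν p` and `|μ| - |ν| = k`. -/
def TailEquiv (x : BPath G) (k : ℤ) (y : BPath G) : Prop :=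
  ∃ (μ ν : FinPath G) (p : BPath G) (hμ : μ.range = p.src) (hν : ν.range = p.src),
    x = BPath.prepend μ p hμ ∧ y = BPath.prepend ν p hν ∧ (μ.length : ℤ) - ν.length = k

namespace TailEquiv

lemma refl (x : BPath G) : TailEquiv x 0 x :=
  ⟨FinPath.vertex G x.src, FinPath.vertex G x.src, x, rfl, rfl,
    (BPath.vertex_prepend x _ rfl).symm, (BPath.vertex_prepend x _ rfl).symm, sub_self _⟩

lemma symm {x y : BPath G} {k : ℤ} : TailEquiv x k y → TailEquiv y (-k) x := by
  rintro ⟨μ, ν, p, hμ, hν, hx, hy, hk⟩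
  exact ⟨ν, μ, p, hν, hμ, hy, hx, by omega⟩

lemma trans {x y z : BPath G} {k l : ℤ} :
    TailEquiv x k y → TailEquiv y l z → TailEquiv x (k + l) z := by
  rintro ⟨μ, ν, p, hμ, hν, hx, hy, hk⟩ ⟨μ', ν', p', hμ', hν', hy', hz, hl⟩
  have key := hy.symm.trans hy'
  rcases le_total ν.length μ'.length with hle | hle
  · obtain ⟨σ, h1, h2, h3, h4⟩ := BPath.exists_of_prepend_eq key hle
    subst h4
    have hμσ : μ.range = σ.src := hμ.trans (BPath.src_prepend σ p' h2)
    refine ⟨μ.append σ hμσ, ν', p', (FinPath.append_range _ _ _).trans h2, hν', ?_, hz, ?_⟩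
    · rw [hx, BPath.append_prepend μ σ p' hμσ h2]
    · have : μ'.length = ν.length + σ.length := by
        rw [h3]; simp [FinPath.append, FinPath.length]
      have : (μ.append σ hμσ).length = μ.length + σ.length := by
        simp [FinPath.append, FinPath.length]
      omega
  · obtain ⟨σ, h1, h2, h3, h4⟩ := BPath.exists_of_prepend_eq key.symm hle
    subst h4
    have hμσ : ν'.range = σ.src := hν'.trans (BPath.src_prepend σ p h2)
    refine ⟨μ, ν'.append σ hμσ, p, hμ, (FinPath.append_range _ _ _).trans h2, hx, ?_, ?_⟩
    · rw [hz, BPath.append_prepend ν' σ p hμσ h2]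
    · have : ν.length = μ'.length + σ.length := by
        rw [h3]; simp [FinPath.append, FinPath.length]
      have : (ν'.append σ hμσ).length = ν'.length + σ.length := by
        simp [FinPath.append, FinPath.length]
      omega

end TailEquiv

/-- An infinite path is rational if it is tail-equivalent (with some lag) to `c^∞` for some closed
path `c`. (A boundary path tail-equivalent to `c^∞` is necessarily infinite.) -/
def IsRational (x : BPath G) : Prop :=
  ∃ (c : ClosedPath G) (k : ℤ), TailEquiv x k c.infPow

/-- The elements `(cod, deg, dom)` of the graph groupoid `𝒢_E`. The unit `(x, 0, x)` is identified
with `x`, so domain and codomain are boundary paths. -/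
@[ext]
structure Arrow (G : DirectedGraph V W) where
  /-- the codomain -/
  cod : BPath G
  /-- the degree -/
  deg : ℤ
  /-- the domain -/
  dom : BPath G
  tail : TailEquiv cod deg dom

namespace Arrow

/-- The unit `(x, 0, x)`. -/
def unit (x : BPath G) : Arrow G := ⟨x, 0, x, .refl x⟩

/-- The inverse `(x, k, y)⁻¹ = (y, -k, x)`. -/
def inv (g : Arrow G) : Arrow G := ⟨g.dom, -g.deg, g.cod, g.tail.symm⟩

/-- The product `(x, k, y)(y, l, z) = (x, k + l, z)`. -/
def comp (g h : Arrow G) (e : g.dom = h.cod) : Arrow G :=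
  ⟨g.cod, g.deg + h.deg, h.dom, g.tail.trans (e ▸ h.tail)⟩

end Arrow

/-- `Z(μ, ν) = {(μ p, |μ| - |ν|, ν p) | p ∈ ∂E, s(p) = r(μ)}`, for `r(μ) = r(ν)`. -/
def cylinder (μ ν : FinPath G) : Set (Arrow G) :=
  {g | ∃ (p : BPath G) (hμ : μ.range = p.src) (hν : ν.range = p.src),
    g.cod = BPath.prepend μ p hμ ∧ g.deg = (μ.length : ℤ) - ν.length ∧
      g.dom = BPath.prepend ν p hν}

/-- The isotropy group of the graph groupoid at `x`. -/
def Isotropy (x : BPath G) : Type _ := {g : Arrow G // g.cod = x ∧ g.dom = x}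

namespace Isotropy

variable {x : BPath G}

/-- The degree `k` of an element `(x, k, x)`. -/
def deg (g : Isotropy x) : ℤ := g.1.deg

lemma ext {g h : Isotropy x} (e : g.deg = h.deg) : g = h :=
  Subtype.ext (Arrow.ext (g.2.1.trans h.2.1.symm) e (g.2.2.trans h.2.2.symm))

instance : CommGroup (Isotropy x) where
  mul g h := ⟨g.1.comp h.1 (g.2.2.trans h.2.1.symm), g.2.1, h.2.2⟩
  one := ⟨Arrow.unit x, rfl, rfl⟩
  inv g := ⟨g.1.inv, g.2.2, g.2.1⟩
  mul_assoc _ _ _ := ext (add_assoc _ _ _)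
  one_mul _ := ext (zero_add _)
  mul_one _ := ext (add_zero _)
  inv_mul_cancel _ := ext (neg_add_cancel _)
  mul_comm _ _ := ext (add_comm _ _)

lemma deg_mul (g h : Isotropy x) : (g * h).deg = g.deg + h.deg := rfl

lemma deg_one : (1 : Isotropy x).deg = 0 := rfl

end Isotropy

/-- `L_x`: the elements of the graph groupoid with domain `x`. -/
def LSet (x : BPath G) : Type _ := {t : Arrow G // t.dom = x}

namespace LSet

variable {x : BPath G}

lemma ext {t u : LSet x} (h : t.1.cod = u.1.cod) (e : t.1.deg = u.1.deg) : t = u :=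
  Subtype.ext (Arrow.ext h e (t.2.trans u.2.symm))

/-- The right action of the isotropy group at `x` on `L_x`, by composition. -/
def mulIso (t : LSet x) (g : Isotropy x) : LSet x :=
  ⟨t.1.comp g.1 (t.2.trans g.2.1.symm), g.2.2⟩

/-- The composition `y t ∈ L_x` for `t ∈ L_x` and `y` with domain the codomain of `t`. -/
def compLeft (t : LSet x) (y : {y : Arrow G // y.dom = t.1.cod}) : LSet x :=
  ⟨y.1.comp t.1 y.2, t.2⟩

end LSet

/-! ## The bimodule `K L_x` -/

variable (K : Type*) [Field K]

/-- The group algebra `K 𝒢_x` of the isotropy group at `x`. It is commutative. -/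
abbrev IsoAlg (x : BPath G) : Type _ := MonoidAlgebra K (Isotropy x)

/-- `K L_x`: the vector space with basis `L_x`. -/
def KL (x : BPath G) : Type _ := LSet x →₀ K

namespace KL

variable {K} {x : BPath G}

instance : AddCommGroup (KL K x) := inferInstanceAs (AddCommGroup (LSet x →₀ K))
instance : Module K (KL K x) := inferInstanceAs (Module K (LSet x →₀ K))

variable (K) in
/-- An element of `L_x` as a basis vector of `K L_x`. -/
def of (t : LSet x) : KL K x := Finsupp.single t (1 : K)

/-- The linear map on `K L_x` with prescribed values on the basis `L_x`. -/
def extend {M : Type*} [AddCommGroup M] [Module K M] (f : LSet x → M) : KL K x →ₗ[K] M :=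
  Finsupp.linearCombination K f

@[simp]
lemma extend_of {M : Type*} [AddCommGroup M] [Module K M] (f : LSet x → M) (t : LSet x) :
    extend (K := K) f (of K t) = f t :=
  (Finsupp.linearCombination_single K 1 t).trans (one_smul K _)

lemma hom_ext {M : Type*} [AddCommGroup M] [Module K M] {f g : KL K x →ₗ[K] M}
    (h : ∀ t, f (of K t) = g (of K t)) : f = g :=
  Finsupp.lhom_ext' fun t => LinearMap.ext_ring (h t)

variable (K x) in
/-- The action of the isotropy group on `K L_x` by composition on the right; the isotropy group
being commutative, a right action is the same as a left action. -/
def isoEnd : Isotropy x →* Module.End K (KL K x) where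
  toFun g := extend fun t => of K (t.mulIso g)
  map_one' := hom_ext fun t => by
    rw [extend_of]
    exact congrArg _ (LSet.ext rfl (add_zero _))
  map_mul' g h := hom_ext fun t => by
    rw [Module.End.mul_apply, extend_of, extend_of, extend_of]
    refine congrArg _ (LSet.ext rfl ?_)
    change t.1.deg + (g.deg + h.deg) = t.1.deg + h.deg + g.deg
    ring

instance : Module (IsoAlg K x) (KL K x) :=
  Module.compHom (KL K x) (MonoidAlgebra.lift K (Module.End K (KL K x)) (Isotropy x)
    (isoEnd K x)).toRingHom

lemma single_smul (g : Isotropy x) (a : K) (w : KL K x) :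
    (MonoidAlgebra.single g a : IsoAlg K x) • w = a • isoEnd K x g w := by
  change MonoidAlgebra.lift K (Module.End K (KL K x)) (Isotropy x) (isoEnd K x)
    (MonoidAlgebra.single g a) w = _
  rw [MonoidAlgebra.lift_single]
  rfl

instance : IsScalarTower K (IsoAlg K x) (KL K x) where
  smul_assoc a b w := by
    change MonoidAlgebra.lift K (Module.End K (KL K x)) (Isotropy x) (isoEnd K x) (a • b) w =
      a • MonoidAlgebra.lift K (Module.End K (KL K x)) (Isotropy x) (isoEnd K x) b w
    rw [map_smul]
    rfl

/-- The action on `K L_x` of a function `f` on the graph groupoid (an element of the Steinberg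
algebra): `f t = ∑_{d(y) = c(t)} f(y) y t` for `t ∈ L_x`. -/
def steinbergAct (f : Arrow G → K) : KL K x →ₗ[K] KL K x :=
  extend fun t => ∑ᶠ y : {y : Arrow G // y.dom = t.1.cod}, f y.1 • of K (t.compLeft y)

/-- The action of the characteristic function of `Z(μ, ν)`. -/
def cylAct (μ ν : FinPath G) : KL K x →ₗ[K] KL K x :=
  steinbergAct (Set.indicator (cylinder μ ν) 1)

lemma cylAct_of {μ ν : FinPath G} {t : LSet x} (p : BPath G) (hμ : μ.range = p.src)
    (hν : ν.range = p.src) (ht : t.1.cod = BPath.prepend ν p hν) (u : LSet x)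
    (hu : u.1.cod = BPath.prepend μ p hμ)
    (hd : u.1.deg = (μ.length : ℤ) - ν.length + t.1.deg) :
    cylAct μ ν (of K t) = of K u := by
  let y : {y : Arrow G // y.dom = t.1.cod} :=
    ⟨⟨BPath.prepend μ p hμ, (μ.length : ℤ) - ν.length, BPath.prepend ν p hν,
      μ, ν, p, hμ, hν, rfl, rfl, rfl⟩, ht.symm⟩
  have hy : y.1 ∈ cylinder μ ν := ⟨p, hμ, hν, rfl, rfl, rfl⟩
  rw [cylAct, steinbergAct, extend_of, finsum_eq_single _ y]
  · rw [Set.indicator_of_mem hy, Pi.one_apply, one_smul]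
    exact congrArg _ (LSet.ext hu.symm hd.symm)
  · intro z hz
    rw [Set.indicator_of_notMem, zero_smul]
    rintro ⟨q, hq1, hq2, hc, hd', hdom⟩
    apply hz
    have : q = p := BPath.prepend_injective (hdom.symm.trans (z.2.trans ht))
    subst this
    exact Subtype.ext (Arrow.ext hc hd' hdom)

lemma cylAct_of_eq_zero {μ ν : FinPath G} {t : LSet x}
    (h : ∀ (p : BPath G), μ.range = p.src → ∀ hν : ν.range = p.src,
      t.1.cod ≠ BPath.prepend ν p hν) :
    cylAct μ ν (of K t) = 0 := by
  rw [cylAct, steinbergAct, extend_of]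
  apply finsum_eq_zero_of_forall_eq_zero
  intro z
  rw [Set.indicator_of_notMem, zero_smul]
  rintro ⟨q, hq1, hq2, hc, hd', hdom⟩
  exact h q hq1 hq2 (z.2.symm.trans hdom)

lemma exists_cylAct_of {μ ν : FinPath G} {t : LSet x} (p : BPath G) (hμ : μ.range = p.src)
    (hν : ν.range = p.src) (ht : t.1.cod = BPath.prepend ν p hν) :
    ∃ u : LSet x, u.1.cod = BPath.prepend μ p hμ ∧
      u.1.deg = (μ.length : ℤ) - ν.length + t.1.deg ∧ cylAct μ ν (of K t) = of K u := by
  obtain ⟨u, hu, hd⟩ : ∃ u : LSet x, u.1.cod = BPath.prepend μ p hμ ∧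
      u.1.deg = (μ.length : ℤ) - ν.length + t.1.deg :=
    ⟨t.compLeft ⟨⟨BPath.prepend μ p hμ, (μ.length : ℤ) - ν.length, BPath.prepend ν p hν,
      μ, ν, p, hμ, hν, rfl, rfl, rfl⟩, ht.symm⟩, rfl, rfl⟩
  exact ⟨u, hu, hd, cylAct_of p hμ hν ht u hu hd⟩

lemma isoEnd_of (g : Isotropy x) (t : LSet x) : isoEnd K x g (of K t) = of K (t.mulIso g) :=
  extend_of _ _

lemma cylAct_isoEnd (μ ν : FinPath G) (g : Isotropy x) (w : KL K x) :
    cylAct μ ν (isoEnd K x g w) = isoEnd K x g (cylAct μ ν w) := by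
  suffices h : (cylAct μ ν).comp (isoEnd K x g) = (isoEnd K x g).comp (cylAct μ ν) from
    LinearMap.congr_fun h w
  refine hom_ext fun t => ?_
  rw [LinearMap.comp_apply, LinearMap.comp_apply, isoEnd_of]
  by_cases h : ∃ (p : BPath G) (_ : μ.range = p.src) (hν : ν.range = p.src),
      t.1.cod = BPath.prepend ν p hν
  · obtain ⟨p, hμ, hν, ht⟩ := h
    obtain ⟨u, hu, hd, hut⟩ := exists_cylAct_of (K := K) p hμ hν ht
    have hdeg : (u.mulIso g).1.deg =
        (μ.length : ℤ) - ν.length + (t.mulIso g).1.deg := by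
      change u.1.deg + g.deg = (μ.length : ℤ) - ν.length + (t.1.deg + g.deg)
      rw [hd, add_assoc]
    rw [hut, isoEnd_of]
    exact cylAct_of p hμ hν (t := t.mulIso g) ht (u.mulIso g) hu hdeg
  · have h' : ∀ (p : BPath G), μ.range = p.src → ∀ hν : ν.range = p.src,
        t.1.cod ≠ BPath.prepend ν p hν := fun p h1 h2 h3 => h ⟨p, h1, h2, h3⟩
    rw [cylAct_of_eq_zero h', cylAct_of_eq_zero (t := t.mulIso g) h', map_zero]

/-- The action of the characteristic function of `Z(μ, ν)`, as an endomorphism of the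
`K 𝒢_x`-module `K L_x`. -/
def cylEnd (μ ν : FinPath G) : Module.End (IsoAlg K x) (KL K x) :=
  { cylAct μ ν with
    map_smul' := by
      intro a w
      change cylAct μ ν (a • w) = a • cylAct μ ν w
      induction a using MonoidAlgebra.induction_linear with
      | zero => simp
      | add a b ha hb => rw [add_smul, add_smul, map_add, ha, hb]
      | single g a => rw [single_smul, single_smul, map_smul, cylAct_isoEnd] }

end KL

/-! ## The Leavitt path algebra -/

/-- The generators `v`, `e`, `e*` of the Leavitt path algebra. -/
inductive Gen (G : DirectedGraph V W)
  | vtx (v : V) : Gen G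
  | edge (e : W) : Gen G
  | ghost (e : W) : Gen G

/-- The defining relations (V), (E1), (E2), (CK1), (CK2) of the Leavitt path algebra. -/
inductive Rel (G : DirectedGraph V W) : FreeAlgebra K (Gen G) → FreeAlgebra K (Gen G) → Prop
  | vtx_mul_self (v : V) :
      Rel G (FreeAlgebra.ι K (.vtx v) * FreeAlgebra.ι K (.vtx v)) (FreeAlgebra.ι K (.vtx v))
  | vtx_mul_of_ne (v w : V) (h : v ≠ w) :
      Rel G (FreeAlgebra.ι K (.vtx v) * FreeAlgebra.ι K (.vtx w)) 0
  | source_mul_edge (e : W) :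
      Rel G (FreeAlgebra.ι K (.vtx (G.s e)) * FreeAlgebra.ι K (.edge e))
        (FreeAlgebra.ι K (.edge e))
  | edge_mul_range (e : W) :
      Rel G (FreeAlgebra.ι K (.edge e) * FreeAlgebra.ι K (.vtx (G.r e)))
        (FreeAlgebra.ι K (.edge e))
  | range_mul_ghost (e : W) :
      Rel G (FreeAlgebra.ι K (.vtx (G.r e)) * FreeAlgebra.ι K (.ghost e))
        (FreeAlgebra.ι K (.ghost e))
  | ghost_mul_source (e : W) :
      Rel G (FreeAlgebra.ι K (.ghost e) * FreeAlgebra.ι K (.vtx (G.s e)))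
        (FreeAlgebra.ι K (.ghost e))
  | ghost_mul_edge_self (e : W) :
      Rel G (FreeAlgebra.ι K (.ghost e) * FreeAlgebra.ι K (.edge e))
        (FreeAlgebra.ι K (.vtx (G.r e)))
  | ghost_mul_edge_of_ne (e f : W) (h : e ≠ f) :
      Rel G (FreeAlgebra.ι K (.ghost e) * FreeAlgebra.ι K (.edge f)) 0
  | sum_edge_mul_ghost (v : V) (hne : (G.s ⁻¹' {v}).Nonempty) (hfin : (G.s ⁻¹' {v}).Finite) :
      Rel G (∑ e ∈ hfin.toFinset, FreeAlgebra.ι K (.edge e) * FreeAlgebra.ι K (.ghost e))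
        (FreeAlgebra.ι K (.vtx v))

/-- The unital algebra presented by the generators and relations of the Leavitt path algebra. As
no relation has a constant term, this is the Leavitt path algebra with a unit adjoined. -/
abbrev UnitalLPA (G : DirectedGraph V W) : Type _ := RingQuot (Rel K G)

/-- A generator as an element of the unital algebra. -/
def unitalGen (g : Gen G) : UnitalLPA K G :=
  RingQuot.mkAlgHom K (Rel K G) (FreeAlgebra.ι K g)

/-- The Leavitt path algebra `L_K(E)`: the (in general non-unital) `K`-algebra presented by the
generators `v`, `e`, `e*` and the relations (V), (E1), (E2), (CK1), (CK2). It is realized inside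
the unital algebra with the same presentation as the non-unital subalgebra generated by the
generators. -/
abbrev LeavittPathAlgebra (G : DirectedGraph V W) : Type _ :=
  NonUnitalAlgebra.adjoin K (Set.range (unitalGen K (G := G)))

namespace LeavittPathAlgebra

/-- A generator as an element of the Leavitt path algebra. -/
def gen (g : Gen G) : LeavittPathAlgebra K G :=
  ⟨unitalGen K g, NonUnitalAlgebra.subset_adjoin K ⟨g, rfl⟩⟩

/-- `e₁ ⋯ eₙ`, written as `e₁ ⋯ eₙ r(eₙ)`; for the path of length zero at `v` it is `v`. -/
def realList (G : DirectedGraph V W) : V → List W → LeavittPathAlgebra K G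
  | v, [] => gen K (.vtx v)
  | _, e :: l => gen K (.edge e) * realList G (G.r e) l

/-- `eₙ* ⋯ e₁*`, written as `r(eₙ) eₙ* ⋯ e₁*`; for the path of length zero at `v` it is `v`. -/
def ghostList (G : DirectedGraph V W) : V → List W → LeavittPathAlgebra K G
  | v, [] => gen K (.vtx v)
  | _, e :: l => ghostList G (G.r e) l * gen K (.ghost e)

/-- The element `μ ν*`. -/
def monomial (μ ν : FinPath G) : LeavittPathAlgebra K G :=
  realList K G μ.src μ.edges * ghostList K G ν.src ν.edges

/-- The homogeneous component of degree `k`: the span of all `μ ν*` with `r(μ) = r(ν)` and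
`|μ| - |ν| = k`. -/
def homogeneous (G : DirectedGraph V W) (k : ℤ) : Submodule K (LeavittPathAlgebra K G) :=
  Submodule.span K {a | ∃ μ ν : FinPath G, μ.range = ν.range ∧
    (μ.length : ℤ) - ν.length = k ∧ a = monomial K μ ν}

variable {K}

/-- Images of the generators that satisfy the relations extend to a homomorphism. -/
def lift {B : Type*} [Ring B] [Algebra K B] (f : Gen G → B)
    (hf : ∀ ⦃a b⦄, Rel K G a b → FreeAlgebra.lift K f a = FreeAlgebra.lift K f b) :
    LeavittPathAlgebra K G →ₙₐ[K] B :=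
  ((RingQuot.liftAlgHom K ⟨FreeAlgebra.lift K f, hf⟩ : UnitalLPA K G →ₐ[K] B) :
      UnitalLPA K G →ₙₐ[K] B).comp
    (NonUnitalSubalgebraClass.subtype _)

lemma lift_gen {B : Type*} [Ring B] [Algebra K B] (f : Gen G → B)
    (hf : ∀ ⦃a b⦄, Rel K G a b → FreeAlgebra.lift K f a = FreeAlgebra.lift K f b) (g : Gen G) :
    lift f hf (gen K g) = f g := by
  change RingQuot.liftAlgHom K ⟨FreeAlgebra.lift K f, hf⟩
    (RingQuot.mkAlgHom K (Rel K G) (FreeAlgebra.ι K g)) = f g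
  rw [RingQuot.liftAlgHom_mkAlgHom_apply, FreeAlgebra.lift_ι_apply]

end LeavittPathAlgebra

/-! ## `K L_x` as a left module over the Leavitt path algebra -/

lemma BPath.exists_edge (x : BPath G) (h : ¬ G.IsSingular x.src) :
    ∃ (e : W) (p : BPath G) (hp : (FinPath.edge G e).range = p.src),
      x = BPath.prepend (FinPath.edge G e) p hp := by
  cases x with
  | fin μ hμ =>
    obtain ⟨v, l, hl⟩ := μ
    cases l with
    | nil => exact absurd hμ h
    | cons e l =>
      obtain ⟨h1, h2⟩ := hl
      refine ⟨e, .fin ⟨G.r e, l, h2⟩ hμ, rfl, ?_⟩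
      subst h1
      rfl
  | inf p =>
    obtain ⟨q, hq⟩ := p
    refine ⟨q.get 0, .inf ⟨q.tail, fun n => hq (n + 1)⟩, hq 0, ?_⟩
    simp only [BPath.prepend, FinPath.edge]
    congr 2
    exact (Stream'.eta q).symm

lemma BPath.edge_eq_of_prepend {e f : W} {p q : BPath G} {hp : (FinPath.edge G e).range = p.src}
    {hq : (FinPath.edge G f).range = q.src}
    (h : BPath.prepend (FinPath.edge G e) p hp = BPath.prepend (FinPath.edge G f) q hq) :
    e = f := by
  obtain ⟨σ, h1, h2, h3, h4⟩ := BPath.exists_of_prepend_eq h (le_refl 1)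
  have := congrArg FinPath.edges h3
  simp [FinPath.edge, FinPath.append] at this
  exact this.1.symm

namespace KL

variable {K} {x : BPath G}

lemma vtx_of {v : V} {t : LSet x} (h : v = t.1.cod.src) :
    cylAct (FinPath.vertex G v) (FinPath.vertex G v) (of K t) = of K t := by
  have h' : (FinPath.vertex G v).range = t.1.cod.src := h
  have ht := (BPath.vertex_prepend t.1.cod v h').symm
  exact cylAct_of t.1.cod h' h' ht t ht (by rw [sub_self, zero_add])

lemma vtx_of_ne {v : V} {t : LSet x} (h : v ≠ t.1.cod.src) :
    cylAct (FinPath.vertex G v) (FinPath.vertex G v) (of K t) = 0 :=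
  cylAct_of_eq_zero fun p h1 h2 h3 => h (by rw [h3, BPath.src_prepend]; rfl)

lemma edge_of {e : W} {t : LSet x} (h : (FinPath.edge G e).range = t.1.cod.src) :
    ∃ u : LSet x, u.1.cod = BPath.prepend (FinPath.edge G e) t.1.cod h ∧
      u.1.deg = 1 + t.1.deg ∧
      cylAct (FinPath.edge G e) (FinPath.vertex G (G.r e)) (of K t) = of K u := by
  have h' : (FinPath.vertex G (G.r e)).range = t.1.cod.src := h
  obtain ⟨u, h1, h2, h3⟩ := exists_cylAct_of (K := K) t.1.cod h h'
    (BPath.vertex_prepend t.1.cod _ h').symm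
  exact ⟨u, h1, h2, h3⟩

lemma edge_of_ne {e : W} {t : LSet x} (h : (FinPath.edge G e).range ≠ t.1.cod.src) :
    cylAct (FinPath.edge G e) (FinPath.vertex G (G.r e)) (of K t) = 0 :=
  cylAct_of_eq_zero fun p h1 h2 h3 => h (by rw [h3, BPath.src_prepend]; rfl)

lemma ghost_of {e : W} {t : LSet x} {p : BPath G} (h : (FinPath.edge G e).range = p.src)
    (ht : t.1.cod = BPath.prepend (FinPath.edge G e) p h) :
    ∃ u : LSet x, u.1.cod = p ∧ u.1.deg = -1 + t.1.deg ∧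
      cylAct (FinPath.vertex G (G.r e)) (FinPath.edge G e) (of K t) = of K u := by
  have h' : (FinPath.vertex G (G.r e)).range = p.src := h
  obtain ⟨u, h1, h2, h3⟩ := exists_cylAct_of (K := K) p h' h ht
  exact ⟨u, h1.trans (BPath.vertex_prepend p _ h'), h2, h3⟩

lemma ghost_of_ne {e : W} {t : LSet x}
    (h : ∀ (p : BPath G) (hp : (FinPath.edge G e).range = p.src),
      t.1.cod ≠ BPath.prepend (FinPath.edge G e) p hp) :
    cylAct (FinPath.vertex G (G.r e)) (FinPath.edge G e) (of K t) = 0 :=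
  cylAct_of_eq_zero fun p _ h2 h3 => h p h2 h3

variable (K x) in
/-- The generators act on `K L_x` as the characteristic functions `v ↦ 1_{Z(v, v)}`,
`e ↦ 1_{Z(e, r(e))}`, `e* ↦ 1_{Z(r(e), e)}`. -/
def genEnd : Gen G → Module.End (IsoAlg K x) (KL K x)
  | .vtx v => cylEnd (FinPath.vertex G v) (FinPath.vertex G v)
  | .edge e => cylEnd (FinPath.edge G e) (FinPath.vertex G (G.r e))
  | .ghost e => cylEnd (FinPath.vertex G (G.r e)) (FinPath.edge G e)

lemma genEnd_vtx (v : V) (w : KL K x) : genEnd K x (.vtx v) w =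
    cylAct (FinPath.vertex G v) (FinPath.vertex G v) w := rfl

lemma genEnd_edge (e : W) (w : KL K x) : genEnd K x (.edge e) w =
    cylAct (FinPath.edge G e) (FinPath.vertex G (G.r e)) w := rfl

lemma genEnd_ghost (e : W) (w : KL K x) : genEnd K x (.ghost e) w =
    cylAct (FinPath.vertex G (G.r e)) (FinPath.edge G e) w := rfl

lemma end_ext {f g : Module.End (IsoAlg K x) (KL K x)} (h : ∀ t, f (of K t) = g (of K t)) :
    f = g :=
  LinearMap.ext fun w => LinearMap.congr_fun
    (hom_ext (f := f.restrictScalars K) (g := g.restrictScalars K) h) w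

lemma genEnd_rel ⦃a b : FreeAlgebra K (Gen G)⦄ (h : Rel K G a b) :
    FreeAlgebra.lift K (genEnd K x) a = FreeAlgebra.lift K (genEnd K x) b := by
  refine end_ext fun t => ?_
  cases h with
  | vtx_mul_self v =>
    simp only [map_mul, FreeAlgebra.lift_ι_apply, Module.End.mul_apply, genEnd_vtx]
    by_cases h : v = t.1.cod.src
    · rw [vtx_of h, vtx_of h]
    · rw [vtx_of_ne h, map_zero]
  | vtx_mul_of_ne v w hne =>
    simp only [map_mul, map_zero, FreeAlgebra.lift_ι_apply, Module.End.mul_apply, genEnd_vtx,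
      LinearMap.zero_apply]
    by_cases h : w = t.1.cod.src
    · rw [vtx_of h, vtx_of_ne (h ▸ hne)]
    · rw [vtx_of_ne h, map_zero]
  | source_mul_edge e =>
    simp only [map_mul, FreeAlgebra.lift_ι_apply, Module.End.mul_apply, genEnd_vtx, genEnd_edge]
    by_cases h : (FinPath.edge G e).range = t.1.cod.src
    · obtain ⟨u, h1, h2, h3⟩ := edge_of (K := K) h
      rw [h3, vtx_of]
      rw [h1, BPath.src_prepend]
      rfl
    · rw [edge_of_ne h, map_zero]
  | edge_mul_range e =>
    simp only [map_mul, FreeAlgebra.lift_ι_apply, Module.End.mul_apply, genEnd_vtx, genEnd_edge]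
    by_cases h : G.r e = t.1.cod.src
    · rw [vtx_of h]
    · rw [vtx_of_ne h, edge_of_ne h, map_zero]
  | range_mul_ghost e =>
    simp only [map_mul, FreeAlgebra.lift_ι_apply, Module.End.mul_apply, genEnd_vtx, genEnd_ghost]
    by_cases h : ∃ (p : BPath G) (hp : (FinPath.edge G e).range = p.src),
      t.1.cod = BPath.prepend (FinPath.edge G e) p hp
    · obtain ⟨p, hp, ht⟩ := h
      obtain ⟨u, h1, h2, h3⟩ := ghost_of (K := K) hp ht
      rw [h3, vtx_of]
      rw [h1]
      exact hp
    · rw [ghost_of_ne fun p hp ht => h ⟨p, hp, ht⟩, map_zero]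
  | ghost_mul_source e =>
    simp only [map_mul, FreeAlgebra.lift_ι_apply, Module.End.mul_apply, genEnd_vtx, genEnd_ghost]
    by_cases h : G.s e = t.1.cod.src
    · rw [vtx_of h]
    · rw [vtx_of_ne h, map_zero, ghost_of_ne]
      intro p hp ht
      apply h
      rw [ht, BPath.src_prepend]
      rfl
  | ghost_mul_edge_self e =>
    simp only [map_mul, FreeAlgebra.lift_ι_apply, Module.End.mul_apply, genEnd_vtx, genEnd_ghost,
      genEnd_edge]
    by_cases h : (FinPath.edge G e).range = t.1.cod.src
    · obtain ⟨u, h1, h2, h3⟩ := edge_of (K := K) h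
      obtain ⟨w, h4, h5, h6⟩ := ghost_of (K := K) h h1
      have h' : G.r e = t.1.cod.src := h
      rw [h3, h6, vtx_of h']
      exact congrArg _ (LSet.ext h4 (by rw [h5, h2]; ring))
    · have h' : G.r e ≠ t.1.cod.src := h
      rw [edge_of_ne h, map_zero, vtx_of_ne h']
  | ghost_mul_edge_of_ne e f hne =>
    simp only [map_mul, map_zero, FreeAlgebra.lift_ι_apply, Module.End.mul_apply, genEnd_ghost,
      genEnd_edge, LinearMap.zero_apply]
    by_cases h : (FinPath.edge G f).range = t.1.cod.src
    · obtain ⟨u, h1, h2, h3⟩ := edge_of (K := K) h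
      rw [h3, ghost_of_ne]
      intro p hp hu
      exact hne (BPath.edge_eq_of_prepend (hu.symm.trans h1))
    · rw [edge_of_ne h, map_zero]
  | sum_edge_mul_ghost v hne hfin =>
    simp only [map_sum, map_mul, FreeAlgebra.lift_ι_apply, Module.End.mul_apply, genEnd_ghost,
      genEnd_edge, genEnd_vtx, LinearMap.sum_apply]
    by_cases h : v = t.1.cod.src
    · have hns : ¬ G.IsSingular t.1.cod.src := by
        rw [← h]
        rintro (h' | h')
        · exact hne.ne_empty h'
        · exact h' hfin
      obtain ⟨e, p, hp, ht⟩ := BPath.exists_edge _ hns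
      have he : G.s e = v := by
        rw [h, ht, BPath.src_prepend]
        rfl
      rw [vtx_of h, Finset.sum_eq_single e]
      · obtain ⟨u, h1, h2, h3⟩ := ghost_of (K := K) hp ht
        subst h1
        obtain ⟨w, h4, h5, h6⟩ := edge_of (K := K) hp
        rw [h3, h6]
        exact congrArg _ (LSet.ext (h4.trans ht.symm) (by rw [h5, h2]; ring))
      · intro f _ hf
        rw [ghost_of_ne, map_zero]
        intro q hq hu
        exact hf (BPath.edge_eq_of_prepend (hu.symm.trans ht))
      · intro h'
        exact absurd (hfin.mem_toFinset.2 he) h'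
    · rw [vtx_of_ne h]
      refine Finset.sum_eq_zero fun e he => ?_
      rw [ghost_of_ne, map_zero]
      intro p hp ht
      apply h
      rw [ht, BPath.src_prepend]
      exact (hfin.mem_toFinset.1 he).symm

variable (K x) in
/-- The left action of the Leavitt path algebra on `K L_x`, by `K 𝒢_x`-endomorphisms. -/
def lpaAct : LeavittPathAlgebra K G →ₙₐ[K] Module.End (IsoAlg K x) (KL K x) :=
  LeavittPathAlgebra.lift (genEnd K x) genEnd_rel

end KL

/-! ## Graded modules -/

section GradedModules

variable {K}
variable {M : Type*} [AddCommGroup M] [Module K M]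
variable {M' : Type*} [AddCommGroup M'] [Module K M']

/-- `M`, with the action `act` of the Leavitt path algebra and the homogeneous components `gr j`,
is a unital graded module. -/
structure IsGradedModule (act : LeavittPathAlgebra K G →ₙₐ[K] Module.End K M)
    (gr : ℤ → Submodule K M) : Prop where
  unital : Submodule.span K {w : M | ∃ a u, w = act a u} = ⊤
  internal : DirectSum.IsInternal gr
  act_mem : ∀ (i j : ℤ), ∀ a ∈ LeavittPathAlgebra.homogeneous K G i, ∀ u ∈ gr j,
    act a u ∈ gr (i + j)

/-- `M` is a graded simple module: a nonzero unital graded module whose only graded submodules are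
`0` and `M`. -/
structure IsGradedSimple (act : LeavittPathAlgebra K G →ₙₐ[K] Module.End K M)
    (gr : ℤ → Submodule K M) : Prop extends IsGradedModule act gr where
  nontrivial : Nontrivial M
  eq_bot_or_eq_top : ∀ P : Submodule K M, (∀ a, ∀ u ∈ P, act a u ∈ P) →
    P = ⨆ j, P ⊓ gr j → P = ⊥ ∨ P = ⊤

/-- Graded isomorphism of graded modules over the Leavitt path algebra. -/
def GradedIso (act : LeavittPathAlgebra K G →ₙₐ[K] Module.End K M) (gr : ℤ → Submodule K M)
    (act' : LeavittPathAlgebra K G →ₙₐ[K] Module.End K M') (gr' : ℤ → Submodule K M') : Prop :=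
  ∃ f : M ≃ₗ[K] M', (∀ a u, f (act a u) = act' a (f u)) ∧ ∀ j u, u ∈ gr j ↔ f u ∈ gr' j

/-- The shift: the `j`-th component of `M(m)` is the `(j + m)`-th component of `M`. -/
def shift (gr : ℤ → Submodule K M) (m : ℤ) : ℤ → Submodule K M := fun j => gr (j + m)

end GradedModules

/-- The homogeneous component of degree `k` of the group algebra `K 𝒢_x`: the span of the elements
of the isotropy group of degree `k`. -/
def isoHomogeneous (x : BPath G) (k : ℤ) : Submodule K (IsoAlg K x) :=
  Submodule.span K {a | ∃ g : Isotropy x, g.deg = k ∧ a = MonoidAlgebra.single g 1}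

/-- The `K 𝒢_x`-module `N` with the homogeneous components `gr j` is a graded module. -/
structure IsGradedIsoModule (x : BPath G) {N : Type*} [AddCommGroup N] [Module K N]
    [Module (IsoAlg K x) N] (gr : ℤ → Submodule K N) : Prop where
  internal : DirectSum.IsInternal gr
  smul_mem : ∀ (i j : ℤ), ∀ a ∈ isoHomogeneous K x i, ∀ u ∈ gr j, a • u ∈ gr (i + j)

/-! ## The induced modules -/

section Ind

variable (x : BPath G) (N : Type*) [AddCommGroup N] [Module (IsoAlg K x) N]

/-- The induced module `Ind_x(N) = K L_x ⊗_{K 𝒢_x} N`. -/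
abbrev Ind : Type _ := KL K x ⊗[IsoAlg K x] N

/-- The action of the Leavitt path algebra on `Ind_x(N)`: `a (t ⊗ u) = (a t) ⊗ u`. -/
def indAct : LeavittPathAlgebra K G →ₙₐ[K] Module.End K (Ind K x N) where
  toFun a := ((KL.lpaAct K x a).rTensor N).restrictScalars K
  map_smul' c a := by
    rw [map_smul]
    refine LinearMap.ext fun w => ?_
    induction w using TensorProduct.induction_on with
    | zero => simp
    | add u v hu hv => rw [map_add, map_add, hu, hv]
    | tmul t n => rfl
  map_zero' := by
    rw [map_zero, LinearMap.rTensor_zero]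
    rfl
  map_add' a b := by
    rw [map_add, LinearMap.rTensor_add]
    rfl
  map_mul' a b := by
    rw [map_mul, LinearMap.rTensor_mul]
    rfl

lemma indAct_tmul (a : LeavittPathAlgebra K G) (t : KL K x) (u : N) :
    indAct K x N a (t ⊗ₜ u) = (KL.lpaAct K x a t) ⊗ₜ u := rfl

variable {N} [Module K N] in
/-- The grading of `Ind_x(N)`: the component of degree `k` is spanned by the `t ⊗ u` with `t ∈ L_x`
of degree `i`, `u` of degree `j` and `i + j = k`. -/
def indGr (gr : ℤ → Submodule K N) (k : ℤ) : Submodule K (Ind K x N) :=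
  Submodule.span K {w | ∃ (t : LSet x) (j : ℤ) (u : N), u ∈ gr j ∧ t.1.deg + j = k ∧
    w = KL.of K t ⊗ₜ[IsoAlg K x] u}

end Ind

/-! ## The module `K[tⁿ, t⁻ⁿ]` over the isotropy group algebra at `c^∞` -/

lemma take_mul_eq {p : Stream' W} {g : ℕ} (h : p.drop g = p) :
    ∀ q : ℕ, p.take (g * q) = (List.replicate q (p.take g)).flatten
  | 0 => by simp
  | q + 1 => by
    rw [List.replicate_succ, List.flatten_cons, ← take_mul_eq h q, Nat.mul_succ, Nat.add_comm,
      Stream'.take_add, h]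

lemma mul_period {p : Stream' W} {n : ℕ} (h : ∀ i, p.get (n + i) = p.get i) :
    ∀ (q i : ℕ), p.get (n * q + i) = p.get i
  | 0, i => by simp
  | q + 1, i => by rw [Nat.mul_succ, Nat.add_right_comm, Nat.add_comm _ n, h, mul_period h q i]

lemma gcd_period {p : Stream' W} (m n : ℕ) (h1 : ∀ i, p.get (m + i) = p.get i)
    (h2 : ∀ i, p.get (n + i) = p.get i) : ∀ i, p.get (Nat.gcd m n + i) = p.get i := by
  induction m, n using Nat.gcd.induction with
  | H0 n => simpa using h2
  | H1 m n hm ih =>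
    rw [Nat.gcd_rec]
    refine ih (fun i => ?_) h1
    rw [← mul_period h1 (n / m), ← h2 i]
    congr 1
    have := Nat.mod_add_div n m
    omega

lemma dvd_of_stream_period {c : SimpleClosedPath G} {a b : ℕ} (hab : a ≤ b)
    (h : ∀ i, (Stream'.cycle c.edges c.ne_nil).get (a + i) =
      (Stream'.cycle c.edges c.ne_nil).get (b + i)) :
    c.length ∣ b - a := by
  have hhead := c.head_eq_src
  have hdrop := c.cycle_drop
  have htake : (Stream'.cycle c.edges c.ne_nil).take c.edges.length = c.edges := by
    conv_lhs => rw [Stream'.cycle_eq]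
    have := Stream'.append_take 0 c.edges (Stream'.cycle c.edges c.ne_nil)
    simpa using this.symm
  generalize Stream'.cycle c.edges c.ne_nil = p at *
  have hpos : 0 < c.edges.length := List.length_pos_of_ne_nil c.ne_nil
  change c.edges.length ∣ b - a
  have hn : ∀ i, p.get (c.edges.length + i) = p.get i := fun i => by
    rw [← Stream'.get_drop, hdrop]
  have hk : ∀ i, p.get (b - a + i) = p.get i := fun i => by
    have hle : a ≤ c.edges.length * a := Nat.le_mul_of_pos_left a hpos
    have e1 := h (c.edges.length * a - a + i)
    have e2 := mul_period hn a i
    have e3 := mul_period hn a (b - a + i)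
    rw [show a + (c.edges.length * a - a + i) = c.edges.length * a + i by omega,
      show b + (c.edges.length * a - a + i) = c.edges.length * a + (b - a + i) by omega,
      e2, e3] at e1
    exact e1.symm
  have hg := gcd_period _ _ hn hk
  have hg0 : 0 < Nat.gcd c.edges.length (b - a) := Nat.gcd_pos_of_pos_left _ hpos
  have hgn := Nat.gcd_dvd_left c.edges.length (b - a)
  have hgk := Nat.gcd_dvd_right c.edges.length (b - a)
  generalize Nat.gcd c.edges.length (b - a) = g at *
  obtain ⟨q, hq⟩ := hgn
  have hgdrop : p.drop g = p := Stream'.ext fun i => by rw [Stream'.get_drop]; exact hg i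
  by_cases h2 : 2 ≤ q
  · exfalso
    have hne : p.take g ≠ [] := by
      intro e
      have := congrArg List.length e
      rw [Stream'.length_take] at this
      exact absurd this hg0.ne'
    have hsplit : c.edges = p.take g ++ p.take (c.edges.length - g) := by
      conv_lhs => rw [← htake]
      have hle : g ≤ c.edges.length := by
        rw [hq]
        exact Nat.le_mul_of_pos_right g (by omega)
      rw [show c.edges.length = g + (c.edges.length - g) by omega, Stream'.take_add, hgdrop]
      simp
    have hlt : 0 < c.edges.length - g := by
      have : g * 2 ≤ g * q := Nat.mul_le_mul_left g h2
      omega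
    have hcc := c.composable
    rw [hsplit, DirectedGraph.composable_append] at hcc
    obtain ⟨m, hm⟩ : ∃ m, c.edges.length - g = m + 1 := ⟨_, (Nat.succ_pred_eq_of_pos hlt).symm⟩
    have hcl : G.target c.src (p.take g) = c.src := by
      have h3 := hcc.2
      rw [hm, Stream'.take_succ] at h3
      rw [← hhead]
      rw [← hhead] at h3
      exact h3.1.symm
    refine c.simple ⟨⟨c.src, p.take g, hcc.1⟩, hne, hcl⟩ q h2 ?_
    change c.edges = (List.replicate q (p.take g)).flatten
    rw [← take_mul_eq hgdrop q, ← hq, htake]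
  · have : q = 1 := by
      rcases Nat.lt_or_ge q 1 with h0 | h1
      · have : q = 0 := by omega
        subst this
        omega
      · omega
    subst this
    rw [Nat.mul_one] at hq
    rw [hq]
    exact hgk

lemma length_dvd_deg (c : SimpleClosedPath G) (g : Isotropy c.infPow) :
    (c.length : ℤ) ∣ g.deg := by
  obtain ⟨⟨y, k, z, μ, ν, p, hμ, hν, hy, hz, hk⟩, h1, h2⟩ := g
  have h1' : y = c.infPow := h1
  have h2' : z = c.infPow := h2
  change (c.length : ℤ) ∣ k
  rw [← hk]
  rw [h1'] at hy
  rw [h2'] at hz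
  cases p with
  | fin ξ hξ => simp [BPath.prepend, ClosedPath.infPow] at hy
  | inf p =>
    simp only [BPath.prepend, ClosedPath.infPow, BPath.inf.injEq, InfPath.mk.injEq] at hy hz
    have key : ∀ i, (Stream'.cycle c.edges c.ne_nil).get (μ.length + i) =
        (Stream'.cycle c.edges c.ne_nil).get (ν.length + i) := by
      intro i
      conv_lhs => rw [hy]
      conv_rhs => rw [hz]
      change (μ.edges ++ₛ p.edges).get (μ.edges.length + i) =
        (ν.edges ++ₛ p.edges).get (ν.edges.length + i)
      rw [Stream'.get_append_right, Stream'.get_append_right]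
    rcases le_total μ.length ν.length with hle | hle
    · have := Int.natCast_dvd_natCast.2 (dvd_of_stream_period hle key)
      rw [Nat.cast_sub hle] at this
      rwa [← dvd_neg, neg_sub]
    · have := Int.natCast_dvd_natCast.2 (dvd_of_stream_period hle fun i => (key i).symm)
      rwa [Nat.cast_sub hle] at this

/-- The subalgebra `K[tⁿ, t⁻ⁿ]` of the Laurent polynomial algebra `K[t, t⁻¹]`. -/
def laurentSub (n : ℕ) : Subalgebra K K[T;T⁻¹] :=
  Algebra.adjoin K {LaurentPolynomial.T (n : ℤ), LaurentPolynomial.T (-n : ℤ)}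

lemma T_mem_laurentSub {n : ℕ} {k : ℤ} (h : (n : ℤ) ∣ k) :
    (LaurentPolynomial.T k : K[T;T⁻¹]) ∈ laurentSub K n := by
  obtain ⟨q, rfl⟩ := h
  rcases Int.eq_nat_or_neg q with ⟨m, rfl | rfl⟩
  · rw [mul_comm, ← LaurentPolynomial.T_pow]
    have h1 : (LaurentPolynomial.T (n : ℤ) : K[T;T⁻¹]) ∈ laurentSub K n :=
      Algebra.subset_adjoin (Set.mem_insert _ _)
    exact pow_mem h1 m
  · rw [show (n : ℤ) * -(m : ℤ) = m * (-n : ℤ) by ring, ← LaurentPolynomial.T_pow]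
    have h1 : (LaurentPolynomial.T (-n : ℤ) : K[T;T⁻¹]) ∈ laurentSub K n :=
      Algebra.subset_adjoin (Set.mem_insert_of_mem _ (Set.mem_singleton _))
    exact pow_mem h1 m

/-- The algebra homomorphism `K 𝒢_{c^∞} → K[tⁿ, t⁻ⁿ]`, `n = |c|`, which sends the element
`(c^∞, k, c^∞)` of the isotropy group to `tᵏ` (it is an isomorphism). -/
def isoToLaurent (c : SimpleClosedPath G) : IsoAlg K c.infPow →ₐ[K] laurentSub K c.length :=
  MonoidAlgebra.lift K (laurentSub K c.length) (Isotropy c.infPow)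
    { toFun := fun g => ⟨LaurentPolynomial.T g.deg, T_mem_laurentSub K (length_dvd_deg c g)⟩
      map_one' := Subtype.ext LaurentPolynomial.T_zero
      map_mul' := fun g h => Subtype.ext (LaurentPolynomial.T_add g.deg h.deg) }

/-- `K[tⁿ, t⁻ⁿ]`, `n = |c|`, as a module over `K 𝒢_{c^∞}`. -/
def LaurentMod (c : SimpleClosedPath G) : Type _ := laurentSub K c.length

namespace LaurentMod

variable (c : SimpleClosedPath G)

instance : AddCommGroup (LaurentMod K c) := inferInstanceAs (AddCommGroup (laurentSub K c.length))
instance : Module K (LaurentMod K c) := inferInstanceAs (Module K (laurentSub K c.length))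
instance : Module (laurentSub K c.length) (LaurentMod K c) :=
  inferInstanceAs (Module (laurentSub K c.length) (laurentSub K c.length))
instance : Module (IsoAlg K c.infPow) (LaurentMod K c) :=
  Module.compHom (LaurentMod K c) (isoToLaurent K c).toRingHom

instance : IsScalarTower K (IsoAlg K c.infPow) (LaurentMod K c) where
  smul_assoc a b w := by
    change (isoToLaurent K c (a • b)) • w = a • (isoToLaurent K c b • w)
    rw [map_smul]
    exact smul_assoc (M := K) (N := laurentSub K c.length) (α := laurentSub K c.length) a _ w

/-- The underlying Laurent polynomial. -/
def toLaurent : LaurentMod K c →ₗ[K] K[T;T⁻¹] := (laurentSub K c.length).val.toLinearMap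

/-- The grading of `K[tⁿ, t⁻ⁿ]` inherited from `K[t, t⁻¹]`: the component of degree `j` is `K tʲ` if
`n` divides `j` and zero otherwise. -/
def gr (j : ℤ) : Submodule K (LaurentMod K c) :=
  (Submodule.span K {LaurentPolynomial.T j}).comap (toLaurent K c)

end LaurentMod

end LPA

end

/-! Everything reduces to the modules `KL_x` with shifted gradings. An isotropy element is
determined by its degree, and for a simple closed path `c` the degrees occurring at `c^∞` are
exactly the multiples of `|c|`. So `K[t^|c|, t^{-|c|}]` is free of rank one over the isotropy group
algebra, and the listed module with parameters `(c, m)` is `KL_{c^∞}` shifted by `m`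
(`gradedIso_indLaurent`).

For infinite `x` the module `KL_x` is graded simple (`KL.isGradedSimple`). Elements of `L_x` of
equal degree have different codomains, and a long enough prefix `μ` of one codomain is a prefix of
none of finitely many others. Hence `μμ*` cuts a nonzero homogeneous vector down to a multiple of
one basis vector. Any basis vector generates, since some `μν*` carries it to any other.

The same projections distinguish the modules. The unit at `p` is fixed by `μμ*` for every prefix `μ`
of `p`, hence so is its image under a graded isomorphism. An element of `L_q` in the support of that
image therefore has codomain `p`, which gives a tail equivalence whose lag is the difference of the
shifts (`KL.exists_tailEquiv_of_gradedIso`). Between `c^∞` and `c'^∞` this makes `c` and `c'`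
rotations of each other, so `c = c'`, and then `|c|` divides `m' - m`.

For completeness no classification of modules over the group algebra is needed. An arrow `g` from
`x` to `y = c^∞` and a nonzero `t ⊗ u`, with `u` homogeneous, give a nonzero graded map `s ↦ sg ⊗ u`
from a shift of `KL_y` to `Ind_x(N)`, an isomorphism by Schur's lemma (`exists_gradedIso_KL`).
Composing `g` with isotropy at `y` changes the shift by multiples of `|c|`, so it can be brought
into `0, …, |c| - 1`. -/

noncomputable section

namespace LPA

variable {V W : Type*} {G : DirectedGraph V W}

/-! ### Initial segments of infinite paths -/

/-- The infinite path obtained by deleting the first `n` edges. -/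
def InfPath.drop (p : InfPath G) (n : ℕ) : InfPath G where
  edges := p.edges.drop n
  composable i := by
    rw [Stream'.get_drop, Stream'.get_drop]
    exact p.composable (n + i)

lemma FinPath.length_append (μ ν : FinPath G) (h : μ.range = ν.src) :
    (μ.append ν h).length = μ.length + ν.length := by
  simp [FinPath.append, FinPath.length]

/-- Supplies prefixes of every length in the `prepend` form used by tail equivalence and cylinders.
-/
lemma InfPath.exists_prepend_drop (p : InfPath G) (n : ℕ) :
    ∃ (μ : FinPath G) (h : μ.range = (BPath.inf (p.drop n)).src), μ.length = n ∧
      BPath.inf p = BPath.prepend μ (.inf (p.drop n)) h := by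
  induction n with
  | zero => exact ⟨FinPath.vertex G p.src, rfl, rfl, rfl⟩
  | succ n ih =>
    obtain ⟨μ, h, hl, hp⟩ := ih
    have he : (FinPath.edge G ((p.drop n).edges.get 0)).range =
        (BPath.inf (p.drop (n + 1))).src := by
      change G.r ((p.edges.drop n).get 0) = G.s ((p.edges.drop (n + 1)).get 0)
      rw [Stream'.get_drop, Stream'.get_drop]
      exact p.composable n
    have hq : BPath.inf (p.drop n) = BPath.prepend (FinPath.edge G ((p.drop n).edges.get 0))
        (.inf (p.drop (n + 1))) he := by
      refine congrArg BPath.inf (InfPath.ext ?_)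
      refine (Stream'.eta _).symm.trans ?_
      change Stream'.cons _ _ = Stream'.cons _ _
      congr 1
      simp [InfPath.drop]
    have hμ : μ.range = (FinPath.edge G ((p.drop n).edges.get 0)).src := by
      rw [h, hq, BPath.src_prepend]
    refine ⟨μ.append _ hμ, (FinPath.append_range _ _ _).trans he, ?_, ?_⟩
    · rw [FinPath.length_append, hl]
      rfl
    · rw [BPath.append_prepend μ _ _ hμ he, hp]
      congr 1

lemma BPath.inf_eq_prepend {p : InfPath G} {μ : FinPath G} {r : BPath G} {h : μ.range = r.src}
    (e : BPath.inf p = BPath.prepend μ r h) :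
    ∃ q : InfPath G, r = .inf q ∧ p.edges = μ.edges ++ₛ q.edges := by
  cases r with
  | fin ν hν => simp [BPath.prepend] at e
  | inf q =>
    simp only [BPath.prepend, BPath.inf.injEq] at e
    exact ⟨q, rfl, congrArg InfPath.edges e⟩

/-- Long initial segments of an infinite path are not initial segments of another given
boundary path. -/
lemma BPath.exists_length_forall_ne_prepend (p : InfPath G) (q : BPath G) (hq : q ≠ .inf p) :
    ∃ N : ℕ, ∀ μ : FinPath G, N ≤ μ.length →
      (∃ (r : BPath G) (h : μ.range = r.src), BPath.inf p = BPath.prepend μ r h) →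
      ∀ (r : BPath G) (h : μ.range = r.src), q ≠ BPath.prepend μ r h := by
  cases q with
  | fin ν hν =>
    -- A finite path has no prefix longer than itself.
    refine ⟨ν.length + 1, ?_⟩
    rintro μ hμ - r h e
    cases r with
    | fin ξ hξ =>
      simp only [BPath.prepend, BPath.fin.injEq] at e
      have hl : ν.length = μ.length + ξ.length := by
        rw [e]
        exact FinPath.length_append μ ξ h
      omega
    | inf r => simp [BPath.prepend] at e
  | inf q =>
    have hne : ∃ i, p.edges.get i ≠ q.edges.get i := by
      by_contra! hall
      exact hq (congrArg BPath.inf (InfPath.ext (Stream'.ext fun i => (hall i).symm)))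
    obtain ⟨i, hi⟩ := hne
    -- A prefix of length at least `i + 1` contains the edge at index `i`, where the two paths
    -- differ.
    refine ⟨i + 1, ?_⟩
    rintro μ hμ ⟨r, h, e⟩ r' h' e'
    obtain ⟨r, rfl, hr⟩ := BPath.inf_eq_prepend e
    obtain ⟨r', rfl, hr'⟩ := BPath.inf_eq_prepend e'
    have hlt : i < μ.edges.length := hμ
    apply hi
    rw [hr, hr', Stream'.get_append_left _ _ _ hlt, Stream'.get_append_left _ _ _ hlt]

/-- An infinite path has an initial segment which separates it from finitely many other boundary
paths. -/
lemma BPath.exists_separating_prefix (p : InfPath G) (S : Set (BPath G)) (hS : S.Finite)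
    (hp : .inf p ∉ S) :
    ∃ μ : FinPath G, (∃ (r : BPath G) (h : μ.range = r.src), BPath.inf p = BPath.prepend μ r h) ∧
      ∀ q ∈ S, ∀ (r : BPath G) (h : μ.range = r.src), q ≠ BPath.prepend μ r h := by
  have hN : ∀ q : BPath G, ∃ N : ℕ, q ∈ S → ∀ μ : FinPath G, N ≤ μ.length →
      (∃ (r : BPath G) (h : μ.range = r.src), BPath.inf p = BPath.prepend μ r h) →
      ∀ (r : BPath G) (h : μ.range = r.src), q ≠ BPath.prepend μ r h := by
    intro q
    by_cases hq : q ∈ S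
    · obtain ⟨N, h⟩ := BPath.exists_length_forall_ne_prepend p q fun e => hp (e ▸ hq)
      exact ⟨N, fun _ => h⟩
    · exact ⟨0, fun h => absurd h hq⟩
  choose N hN using hN
  -- One prefix as long as all the bounds over the finite set `S` separates `p` from every member of
  -- `S`.
  obtain ⟨μ, h, hl, e⟩ := p.exists_prepend_drop (hS.toFinset.sup N)
  refine ⟨μ, ⟨_, h, e⟩, fun q hq => hN q hq μ ?_ ⟨_, h, e⟩⟩
  rw [hl]
  exact Finset.le_sup (hS.mem_toFinset.2 hq)

/-- The common tail is infinite because it is a tail of `p`. Hence all codomains in `L_p` are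
infinite and can be separated by prefixes. -/
lemma TailEquiv.exists_eq_inf {y : BPath G} {k : ℤ} {p : InfPath G} (h : TailEquiv y k (.inf p)) :
    ∃ q, y = .inf q := by
  obtain ⟨μ, ν, r, hμ, hν, hy, hx, -⟩ := h
  obtain ⟨q, rfl, -⟩ := BPath.inf_eq_prepend hx
  exact ⟨_, hy⟩

/-! ### Periodic paths -/

/-- Both streams have period `k`, so strong induction on the index reduces to indices below `k`. -/
lemma cycle_take {s : Stream' W} {k : ℕ} (hs : s.drop k = s) (hne : s.take k ≠ []) :
    Stream'.cycle (s.take k) hne = s := by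
  have hlen : (s.take k).length = k := Stream'.length_take k s
  have hk : 0 < k := hlen ▸ List.length_pos_of_ne_nil hne
  have key : ∀ i, (Stream'.cycle (s.take k) hne).get i = s.get i := by
    intro i
    induction i using Nat.strong_induction_on with
    | _ i ih =>
      rw [Stream'.cycle_eq]
      by_cases hi : i < k
      · rw [Stream'.get_append_left _ _ _ (hlen.symm ▸ hi), Stream'.take_get]
      · have e : i = (s.take k).length + (i - k) := by omega
        conv_lhs => rw [e]
        rw [Stream'.get_append_right, ih _ (by omega)]
        conv_lhs => rw [← hs]
        rw [Stream'.get_drop]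
        congr 1
        omega
  exact Stream'.ext key

lemma take_cycle (l : List W) (h : l ≠ []) : (Stream'.cycle l h).take l.length = l := by
  conv_lhs => rw [Stream'.cycle_eq]
  have := Stream'.append_take 0 l (Stream'.cycle l h)
  simpa using this.symm

/-- Indices modulo the length are the form in which infinite powers can be compared with rotated
lists. -/
lemma cycle_get (l : List W) (h : l ≠ []) (i : ℕ) :
    (Stream'.cycle l h).get i =
      l[i % l.length]'(Nat.mod_lt _ (List.length_pos_of_ne_nil h)) := by
  have hper : ∀ i, (Stream'.cycle l h).get (l.length + i) = (Stream'.cycle l h).get i := by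
    intro i
    conv_lhs => rw [Stream'.cycle_eq]
    rw [Stream'.get_append_right]
  have := mul_period hper (i / l.length) (i % l.length)
  rw [Nat.div_add_mod] at this
  rw [this, Stream'.cycle_eq, Stream'.get_append_left]

lemma ClosedPath.infPow_eq_iff {c d : ClosedPath G} :
    c.infPow = d.infPow ↔ Stream'.cycle c.edges c.ne_nil = Stream'.cycle d.edges d.ne_nil := by
  simp [ClosedPath.infPow]

/-- The stream `d^∞` also has period `n|d|`, and its first `n|d|` edges are those of `c`. -/
lemma ClosedPath.infPow_eq_of_edges_eq_flatten {c d : ClosedPath G} {n : ℕ}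
    (h : c.edges = (List.replicate n d.edges).flatten) : c.infPow = d.infPow := by
  have hdrop : ∀ q : ℕ, (Stream'.cycle d.edges d.ne_nil).drop (d.edges.length * q) =
      Stream'.cycle d.edges d.ne_nil := by
    intro q
    refine Stream'.ext fun i => ?_
    rw [Stream'.get_drop]
    refine mul_period (fun i => ?_) q i
    rw [← Stream'.get_drop, d.cycle_drop]
  have htake : (Stream'.cycle d.edges d.ne_nil).take (d.edges.length * n) = c.edges := by
    rw [take_mul_eq d.cycle_drop, take_cycle, h]
  -- The list is generalized because `Stream'.cycle` carries a proof that it is nonempty, which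
  -- blocks a direct rewrite.
  have key : ∀ (l : List W) (hl : l ≠ []),
      (Stream'.cycle d.edges d.ne_nil).take (d.edges.length * n) = l →
      Stream'.cycle l hl = Stream'.cycle d.edges d.ne_nil := by
    rintro l hl rfl
    exact cycle_take (hdrop n) hl
  exact ClosedPath.infPow_eq_iff.2 (key _ _ htake)

/-- Every infinite power of a closed path is the infinite power of a simple closed path. -/
lemma ClosedPath.exists_simple (d : ClosedPath G) :
    ∃ c : SimpleClosedPath G, c.infPow = d.infPow := by
  induction hn : d.edges.length using Nat.strong_induction_on generalizing d with
  | _ n ih =>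
    by_cases h : ∀ (e : ClosedPath G) (n : ℕ), 2 ≤ n →
        d.edges ≠ (List.replicate n e.edges).flatten
    · exact ⟨⟨d, h⟩, rfl⟩
    · push Not at h
      obtain ⟨e, m, hm, he⟩ := h
      have hlen : d.edges.length = m * e.edges.length := by
        rw [he]
        simp
      have hpos := List.length_pos_of_ne_nil e.ne_nil
      -- The root `e` is strictly shorter than `d`, since `m ≥ 2` and `e` has positive length.
      obtain ⟨c, hc⟩ := ih e.edges.length (by nlinarith) e rfl
      exact ⟨c, hc.trans (ClosedPath.infPow_eq_of_edges_eq_flatten he).symm⟩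

/-- If `d` is `c` rotated by `k`, deleting the first `k` edges of `c^∞` leaves `d^∞`. -/
lemma ClosedPath.exists_tailEquiv_of_isRotated {c d : ClosedPath G}
    (h : c.edges ~r d.edges) : ∃ k, TailEquiv c.infPow k d.infPow := by
  obtain ⟨k, hk⟩ := h
  obtain ⟨p, hp⟩ : ∃ p, c.infPow = .inf p := ⟨_, rfl⟩
  obtain ⟨μ, hμ, hl, e⟩ := p.exists_prepend_drop k
  have hd : d.infPow = .inf (p.drop k) := by
    refine congrArg BPath.inf (InfPath.ext (Stream'.ext fun i => ?_))
    have hpe : Stream'.cycle c.edges c.ne_nil = p.edges := by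
      have := BPath.inf.inj hp
      exact congrArg InfPath.edges this
    change (Stream'.cycle d.edges d.ne_nil).get i = (p.edges.drop k).get i
    rw [Stream'.get_drop, ← hpe, cycle_get, cycle_get]
    simp only [← hk, List.getElem_rotate, List.length_rotate, Nat.mod_add_mod, Nat.add_comm k]
  refine ⟨(μ.length : ℤ) - 0, μ, FinPath.vertex G (p.drop k).src, .inf (p.drop k), hμ, rfl, ?_, ?_,
    rfl⟩
  · rw [hp, e]
  · rw [hd]
    exact (BPath.vertex_prepend _ _ rfl).symm

/-- The common tail `q` has both `|c|` and `|d|` as periods. Simplicity of each path makes its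
length divide the other, so the lengths agree, and an initial segment of `q` of that length is a
rotation of `c` and of `d`. -/
lemma SimpleClosedPath.isRotation_of_tailEquiv {c d : SimpleClosedPath G} {k : ℤ}
    (h : TailEquiv c.infPow k d.infPow) : c.IsRotation d := by
  obtain ⟨μ, ν, r, hμ, hν, hc, hd, -⟩ := h
  obtain ⟨q, rfl, hc'⟩ := BPath.inf_eq_prepend hc
  obtain ⟨q', hq', hd'⟩ := BPath.inf_eq_prepend hd
  obtain rfl : q = q' := BPath.inf.inj hq'
  replace hc : Stream'.cycle c.edges c.ne_nil = μ.edges ++ₛ q.edges := hc'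
  replace hd : Stream'.cycle d.edges d.ne_nil = ν.edges ++ₛ q.edges := hd'
  have hqc : ∀ i, q.edges.get i = (Stream'.cycle c.edges c.ne_nil).get (μ.edges.length + i) := by
    intro i
    rw [hc, Stream'.get_append_right]
  have hqd : ∀ i, q.edges.get i = (Stream'.cycle d.edges d.ne_nil).get (ν.edges.length + i) := by
    intro i
    rw [hd, Stream'.get_append_right]
  have perc : ∀ i, (Stream'.cycle c.edges c.ne_nil).get (c.edges.length + i) =
      (Stream'.cycle c.edges c.ne_nil).get i := fun i => by rw [← Stream'.get_drop, c.cycle_drop]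
  have perd : ∀ i, (Stream'.cycle d.edges d.ne_nil).get (d.edges.length + i) =
      (Stream'.cycle d.edges d.ne_nil).get i := fun i => by rw [← Stream'.get_drop, d.cycle_drop]
  -- `q` is the tail of `d^∞` from index `|ν|` and has period `|c|`, so `d^∞` agrees with itself
  -- from `|ν|` and from `|c| + |ν|` on; simplicity of `d` enters through `dvd_of_stream_period`.
  have hdc : d.edges.length ∣ c.edges.length := by
    have := dvd_of_stream_period (c := d) (a := ν.edges.length)
      (b := c.edges.length + ν.edges.length) (by omega) fun i => by
        rw [← hqd, Nat.add_right_comm, Nat.add_comm, ← hqd, hqc, hqc, ← perc]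
        congr 1
        omega
    rwa [Nat.add_sub_cancel] at this
  have hcd : c.edges.length ∣ d.edges.length := by
    have := dvd_of_stream_period (c := c) (a := μ.edges.length)
      (b := d.edges.length + μ.edges.length) (by omega) fun i => by
        rw [← hqc, Nat.add_right_comm, Nat.add_comm, ← hqc, hqd, hqd, ← perd]
        congr 1
        omega
    rwa [Nat.add_sub_cancel] at this
  have hlen := Nat.dvd_antisymm hcd hdc
  have hrot : c.edges.rotate μ.edges.length = d.edges.rotate ν.edges.length := by
    refine List.ext_getElem (by simpa using hlen) fun i h1 h2 => ?_
    rw [List.length_rotate] at h1 h2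
    have e := (hqc i).symm.trans (hqd i)
    rw [cycle_get, cycle_get] at e
    rw [List.getElem_rotate, List.getElem_rotate]
    simpa only [Nat.add_comm] using e
  have h1 : c.edges ~r c.edges.rotate μ.edges.length := ⟨_, rfl⟩
  have h2 : d.edges ~r d.edges.rotate ν.edges.length := ⟨_, rfl⟩
  exact h1.trans (hrot ▸ h2.symm)

/-- This is `c^∞ = c c^∞`, with `c` and its source vertex as the two finite paths. -/
lemma ClosedPath.tailEquiv_infPow_length (c : ClosedPath G) :
    TailEquiv c.infPow (c.length : ℤ) c.infPow := by
  have hsrc : c.infPow.src = c.src := c.head_eq_src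
  refine ⟨c.toFinPath, FinPath.vertex G c.src, c.infPow, c.closed.trans hsrc.symm, hsrc.symm, ?_,
    (BPath.vertex_prepend _ _ hsrc.symm).symm, by simp [FinPath.vertex, FinPath.length]⟩
  exact congrArg BPath.inf (InfPath.ext (Stream'.cycle_eq _ c.ne_nil))

/-- Converse of `length_dvd_deg`; it makes the map to Laurent polynomials surjective and lets shifts
be reduced modulo `|c|`. -/
lemma ClosedPath.tailEquiv_infPow_mul_length (c : ClosedPath G) (q : ℤ) :
    TailEquiv c.infPow (q * c.length) c.infPow := by
  have hnat : ∀ n : ℕ, TailEquiv c.infPow (n * c.length) c.infPow := by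
    intro n
    induction n with
    | zero => simpa using TailEquiv.refl c.infPow
    | succ n ih =>
      have := ih.trans c.tailEquiv_infPow_length
      rwa [show ((n : ℤ) * c.length + c.length) = ((n + 1 : ℕ) : ℤ) * c.length by
        push_cast; ring] at this
  rcases Int.eq_nat_or_neg q with ⟨n, rfl | rfl⟩
  · exact hnat n
  · rw [neg_mul]
    exact (hnat n).symm

/-! ### The action of the elements `μ ν*` on `K L_x` -/

lemma DirectedGraph.Composable.tail {v : V} {e : W} {l : List W} (hc : G.Composable v (e :: l)) :
    G.Composable (G.r e) l := hc.2

/-- Peels off the first edge, matching the recursions of `realList` and `ghostList`. -/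
lemma BPath.prepend_cons {v : V} {e : W} {l : List W} (hc : G.Composable v (e :: l)) (p : BPath G)
    (h : (FinPath.mk v (e :: l) hc).range = p.src) :
    prepend ⟨v, e :: l, hc⟩ p h = prepend (FinPath.edge G e) (prepend ⟨G.r e, l, hc.tail⟩ p h)
      (src_prepend ⟨G.r e, l, hc.tail⟩ p h).symm := by
  obtain rfl : G.s e = v := hc.1
  exact append_prepend (FinPath.edge G e) ⟨G.r e, l, hc.tail⟩ p rfl h

namespace KL

variable {K : Type*} [Field K] {x : BPath G}

open LeavittPathAlgebra

lemma lpaAct_gen (g : Gen G) (w : KL K x) : lpaAct K x (gen K g) w = genEnd K x g w := by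
  rw [lpaAct, lift_gen]

lemma lpaAct_mul (a b : LeavittPathAlgebra K G) (w : KL K x) :
    lpaAct K x (a * b) w = lpaAct K x a (lpaAct K x b w) := by
  rw [map_mul, Module.End.mul_apply]

/-- The resulting basis vector is described by codomain and degree alone: these determine an element
of `L_x`, so no explicit arrow has to be carried through the induction. -/
lemma exists_lpaAct_ghostList_of {v : V} {l : List W} (hc : G.Composable v l) {p : BPath G}
    (h : (FinPath.mk v l hc).range = p.src) {t : LSet x}
    (ht : t.1.cod = BPath.prepend ⟨v, l, hc⟩ p h) :
    ∃ u : LSet x, u.1.cod = p ∧ u.1.deg = -l.length + t.1.deg ∧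
      lpaAct K x (ghostList K G v l) (of K t) = of K u := by
  induction l generalizing v t with
  | nil =>
    have ht' : t.1.cod = p := ht.trans (BPath.vertex_prepend p v h)
    refine ⟨t, ht', by simp, ?_⟩
    rw [ghostList, lpaAct_gen, genEnd_vtx, vtx_of]
    rw [ht']
    exact h
  | cons e l ih =>
    rw [BPath.prepend_cons] at ht
    obtain ⟨u, hu, hd, hut⟩ := ghost_of (K := K) _ ht
    obtain ⟨u', hu', hd', hut'⟩ := ih hc.tail h hu
    refine ⟨u', hu', ?_, ?_⟩
    · rw [hd', hd, List.length_cons]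
      push_cast
      ring
    · rw [ghostList, lpaAct_mul, lpaAct_gen, genEnd_ghost, hut, hut']

lemma lpaAct_ghostList_of_eq_zero {v : V} {l : List W} (hc : G.Composable v l) {t : LSet x}
    (ht : ∀ (p : BPath G) (h : (FinPath.mk v l hc).range = p.src),
      t.1.cod ≠ BPath.prepend ⟨v, l, hc⟩ p h) :
    lpaAct K x (ghostList K G v l) (of K t) = 0 := by
  induction l generalizing v t with
  | nil =>
    rw [ghostList, lpaAct_gen, genEnd_vtx, vtx_of_ne]
    exact fun h => ht t.1.cod h (BPath.vertex_prepend t.1.cod v h).symm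
  | cons e l ih =>
    rw [ghostList, lpaAct_mul, lpaAct_gen, genEnd_ghost]
    by_cases h : ∃ (p : BPath G) (hp : (FinPath.edge G e).range = p.src),
      t.1.cod = BPath.prepend (FinPath.edge G e) p hp
    · obtain ⟨p, hp, htp⟩ := h
      obtain ⟨u, hu, -, hut⟩ := ghost_of (K := K) hp htp
      rw [hut]
      refine ih hc.tail fun q hq e' => ht q hq ?_
      subst hu
      refine htp.trans (Eq.trans ?_ (BPath.prepend_cons hc q hq).symm)
      congr 1
    · rw [ghost_of_ne fun p hp htp => h ⟨p, hp, htp⟩, map_zero]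

lemma exists_lpaAct_realList_of {v : V} {l : List W} (hc : G.Composable v l) {t : LSet x}
    (h : (FinPath.mk v l hc).range = t.1.cod.src) :
    ∃ u : LSet x, u.1.cod = BPath.prepend ⟨v, l, hc⟩ t.1.cod h ∧ u.1.deg = l.length + t.1.deg ∧
      lpaAct K x (realList K G v l) (of K t) = of K u := by
  induction l generalizing v with
  | nil =>
    refine ⟨t, (BPath.vertex_prepend _ v h).symm, by simp, ?_⟩
    rw [realList, lpaAct_gen, genEnd_vtx]
    exact vtx_of h
  | cons e l ih =>
    obtain ⟨u, hu, hd, hut⟩ := ih hc.tail h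
    have he : (FinPath.edge G e).range = u.1.cod.src := by
      rw [hu]
      exact (BPath.src_prepend ⟨G.r e, l, hc.tail⟩ _ h).symm
    obtain ⟨u', hu', hd', hut'⟩ := edge_of (K := K) he
    refine ⟨u', ?_, ?_, ?_⟩
    · rw [hu', BPath.prepend_cons]
      congr 1
    · rw [hd', hd, List.length_cons]
      push_cast
      ring
    · rw [realList, lpaAct_mul, hut, lpaAct_gen, genEnd_edge, hut']

/-- Identifies the action, defined on generators, with the groupoid formula `νp ↦ μp`. -/
lemma exists_lpaAct_monomial_of {μ ν : FinPath G} {p : BPath G} (hμ : μ.range = p.src)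
    (hν : ν.range = p.src) {t : LSet x} (ht : t.1.cod = BPath.prepend ν p hν) :
    ∃ u : LSet x, u.1.cod = BPath.prepend μ p hμ ∧
      u.1.deg = (μ.length : ℤ) - ν.length + t.1.deg ∧
      lpaAct K x (monomial K μ ν) (of K t) = of K u := by
  obtain ⟨u, rfl, hd, hut⟩ := exists_lpaAct_ghostList_of (K := K) ν.composable hν ht
  obtain ⟨u', hu', hd', hut'⟩ := exists_lpaAct_realList_of (K := K) μ.composable hμ
  refine ⟨u', hu', ?_, ?_⟩
  · rw [hd', hd]
    simp only [FinPath.length]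
    ring
  · rw [monomial, lpaAct_mul, hut, hut']

lemma lpaAct_monomial_of_eq_zero {μ ν : FinPath G} {t : LSet x}
    (ht : ∀ (p : BPath G) (h : ν.range = p.src), t.1.cod ≠ BPath.prepend ν p h) :
    lpaAct K x (monomial K μ ν) (of K t) = 0 := by
  rw [monomial, lpaAct_mul, lpaAct_ghostList_of_eq_zero ν.composable ht, map_zero]

/-- With `lpaAct_monomial_of_eq_zero`, this makes `μμ*` a diagonal projection in the basis `L_x`,
onto the elements whose codomain begins with `μ`. -/
lemma lpaAct_monomial_self_of {μ : FinPath G} {t : LSet x}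
    (ht : ∃ (p : BPath G) (h : μ.range = p.src), t.1.cod = BPath.prepend μ p h) :
    lpaAct K x (monomial K μ μ) (of K t) = of K t := by
  obtain ⟨p, h, ht⟩ := ht
  obtain ⟨u, hu, hd, hut⟩ := exists_lpaAct_monomial_of (K := K) h h ht
  rw [hut, LSet.ext (hu.trans ht.symm) (by rw [hd]; ring)]

/-! ### Coefficients -/

/-- The coefficient of a vector of `K L_x` at an element of `L_x`. -/
def coeff (t : LSet x) : KL K x →ₗ[K] K := Finsupp.lapply t

lemma coeff_of_self (t : LSet x) : coeff t (of K t) = 1 := Finsupp.single_eq_same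

lemma coeff_of_ne {s t : LSet x} (h : s ≠ t) : coeff s (of K t) = 0 :=
  Finsupp.single_eq_of_ne h

lemma ext_coeff {w w' : KL K x} (h : ∀ t, coeff t w = coeff t w') : w = w' :=
  Finsupp.ext h

lemma finite_coeff_ne_zero (w : KL K x) : {t | coeff t w ≠ 0}.Finite :=
  Finsupp.hasFiniteSupport w

variable (K x) in
/-- The basis `L_x` of `K L_x`. -/
def basis : Module.Basis (LSet x) K (KL K x) := Finsupp.basisSingleOne

lemma basis_apply (t : LSet x) : basis K x t = of K t := by
  simp only [basis]
  rfl

lemma coeff_lpaAct_monomial_self (μ : FinPath G) (t : LSet x) (w : KL K x)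
    (ht : ∃ (p : BPath G) (h : μ.range = p.src), t.1.cod = BPath.prepend μ p h) :
    coeff t (lpaAct K x (monomial K μ μ) w) = coeff t w := by
  refine LinearMap.congr_fun (hom_ext (f := (coeff t).comp
    ((lpaAct K x (monomial K μ μ)).restrictScalars K)) (g := coeff t) fun s => ?_) w
  change coeff t (lpaAct K x (monomial K μ μ) (of K s)) = _
  by_cases hs : ∃ (p : BPath G) (h : μ.range = p.src), s.1.cod = BPath.prepend μ p h
  · rw [lpaAct_monomial_self_of hs]
  · rw [lpaAct_monomial_of_eq_zero fun p h e => hs ⟨p, h, e⟩, map_zero, coeff_of_ne]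
    rintro rfl
    exact hs ht

lemma coeff_lpaAct_monomial_self_eq_zero (μ : FinPath G) (t : LSet x) (w : KL K x)
    (ht : ∀ (p : BPath G) (h : μ.range = p.src), t.1.cod ≠ BPath.prepend μ p h) :
    coeff t (lpaAct K x (monomial K μ μ) w) = 0 := by
  refine LinearMap.congr_fun (hom_ext (f := (coeff t).comp
    ((lpaAct K x (monomial K μ μ)).restrictScalars K)) (g := 0) fun s => ?_) w
  change coeff t (lpaAct K x (monomial K μ μ) (of K s)) = 0
  by_cases hs : ∃ (p : BPath G) (h : μ.range = p.src), s.1.cod = BPath.prepend μ p h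
  · rw [lpaAct_monomial_self_of hs, coeff_of_ne]
    rintro rfl
    obtain ⟨p, h, e⟩ := hs
    exact ht p h e
  · rw [lpaAct_monomial_of_eq_zero fun p h e => hs ⟨p, h, e⟩, map_zero]

end KL

/-! ### `K L_x` as a graded module -/

section Basis

variable {K M ι : Type*} [Field K] [AddCommGroup M] [Module K M]

/-- Assigning degrees to the elements of a basis gives an internal grading. -/
lemma isInternal_span_basis (b : Module.Basis ι K M) (d : ι → ℤ) :
    DirectSum.IsInternal fun k => Submodule.span K {w | ∃ i, d i = k ∧ w = b i} := by
  have hset : ∀ k, {w | ∃ i, d i = k ∧ w = b i} = b '' (d ⁻¹' {k}) := by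
    intro k
    ext w
    simp [eq_comm]
  rw [DirectSum.isInternal_submodule_iff_iSupIndep_and_iSup_eq_top]
  constructor
  · intro k
    simp only [hset]
    -- The other components all lie in the span of the basis vectors of degree different from `k`.
    refine (b.linearIndependent.disjoint_span_image (s := d ⁻¹' {k}) (t := (d ⁻¹' {k})ᶜ)
      disjoint_compl_right).mono_right ?_
    refine iSup₂_le fun j hj => Submodule.span_mono ?_
    refine Set.image_mono fun i hi => ?_
    rintro rfl
    exact hj hi.symm
  · rw [eq_top_iff, ← b.span_eq, Submodule.span_le]
    rintro _ ⟨i, rfl⟩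
    exact Submodule.mem_iSup_of_mem (d i) (Submodule.subset_span ⟨i, rfl, rfl⟩)

end Basis

namespace KL

variable {K : Type*} [Field K] {x : BPath G}

variable (K x) in
/-- The action of the Leavitt path algebra on the vector space `K L_x`. -/
def act : LeavittPathAlgebra K G →ₙₐ[K] Module.End K (KL K x) where
  toFun a := (lpaAct K x a).restrictScalars K
  map_smul' c a := by
    rw [map_smul]
    rfl
  map_zero' := by
    rw [map_zero]
    rfl
  map_add' a b := by
    rw [map_add]
    rfl
  map_mul' a b := by
    rw [map_mul]
    rfl

variable (K x) in
/-- The grading of `K L_x` by degree, shifted by `m`. -/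
def gr (m k : ℤ) : Submodule K (KL K x) :=
  Submodule.span K {w | ∃ t : LSet x, t.1.deg = k + m ∧ w = of K t}

lemma of_mem_gr {m k : ℤ} {t : LSet x} (h : t.1.deg = k + m) : of K t ∈ gr K x m k :=
  Submodule.subset_span ⟨t, h, rfl⟩

/-- The component lies in the kernel of every coefficient functional at another degree. -/
lemma deg_of_mem_gr {m k : ℤ} {w : KL K x} (hw : w ∈ gr K x m k) {t : LSet x}
    (ht : coeff t w ≠ 0) : t.1.deg = k + m := by
  contrapose! ht
  have hle : gr K x m k ≤ LinearMap.ker (coeff t) := by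
    rw [gr, Submodule.span_le]
    rintro _ ⟨s, hs, rfl⟩
    refine coeff_of_ne ?_
    rintro rfl
    exact ht hs
  exact hle hw

lemma isInternal_gr (m : ℤ) : DirectSum.IsInternal (gr K x m) := by
  have := isInternal_span_basis (basis K x) fun t => t.1.deg - m
  simp only [basis_apply, sub_eq_iff_eq_add] at this
  exact this

lemma isGradedModule (m : ℤ) : IsGradedModule (act K x) (gr K x m) where
  unital := by
    rw [eq_top_iff, ← (basis K x).span_eq, Submodule.span_le]
    rintro _ ⟨t, rfl⟩
    -- Each basis vector is fixed by the vertex at which its codomain starts.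
    refine Submodule.subset_span
      ⟨LeavittPathAlgebra.gen K (.vtx t.1.cod.src), of K t, ?_⟩
    rw [basis_apply]
    exact ((lpaAct_gen _ _).trans (vtx_of rfl)).symm
  internal := isInternal_gr m
  act_mem i j a ha u hu := by
    -- By bilinearity it suffices to let a monomial `μν*` act on a basis vector.
    have hle : LeavittPathAlgebra.homogeneous K G i ≤
        ((gr K x m (i + j)).comap (LinearMap.applyₗ u)).comap (act K x : _ →ₗ[K] _) := by
      rw [LeavittPathAlgebra.homogeneous, Submodule.span_le]
      rintro _ ⟨μ, ν, hr, hd, rfl⟩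
      change lpaAct K x _ u ∈ gr K x m (i + j)
      have hle : gr K x m j ≤ (gr K x m (i + j)).comap
          ((lpaAct K x (LeavittPathAlgebra.monomial K μ ν)).restrictScalars K) := by
        rw [gr, Submodule.span_le]
        rintro _ ⟨t, ht, rfl⟩
        change lpaAct K x _ (of K t) ∈ gr K x m (i + j)
        by_cases h : ∃ (p : BPath G) (h : ν.range = p.src), t.1.cod = BPath.prepend ν p h
        · obtain ⟨p, hp, htp⟩ := h
          obtain ⟨s, -, hs, e⟩ := exists_lpaAct_monomial_of (K := K) (hr.trans hp) hp htp
          rw [e]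
          refine of_mem_gr ?_
          rw [hs, hd, ht, add_assoc]
        · rw [lpaAct_monomial_of_eq_zero fun p hp e => h ⟨p, hp, e⟩]
          exact zero_mem _
      exact hle hu
    exact hle ha

/-! ### Graded simplicity of `KL_x` for infinite `x` -/

/-- The codomains of `s` and `t` are tail-equivalent with lag `deg s - deg t`, both arrows having
domain `x`. Writing them as `μp` and `νp`, the element `μν*` sends `t` to `s`. -/
lemma eq_top_of_of_mem {P : Submodule K (KL K x)} (hP : ∀ a, ∀ u ∈ P, act K x a u ∈ P)
    {t : LSet x} (ht : of K t ∈ P) : P = ⊤ := by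
  rw [eq_top_iff, ← (basis K x).span_eq, Submodule.span_le]
  rintro _ ⟨s, rfl⟩
  rw [basis_apply]
  have hs : TailEquiv s.1.cod (s.1.deg + -t.1.deg) t.1.cod := by
    have h1 := s.1.tail
    have h2 := t.1.tail.symm
    rw [s.2] at h1
    rw [t.2] at h2
    exact h1.trans h2
  obtain ⟨μ, ν, p, hμ, hν, hy, hz, hk⟩ := hs
  obtain ⟨u, hu, hd, e⟩ := exists_lpaAct_monomial_of (K := K) hμ hν hz
  obtain rfl : u = s := LSet.ext (hu.trans hy.symm) (by omega)
  rw [SetLike.mem_coe, ← e]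
  exact hP _ _ ht

/-- A nonzero graded submodule contains a nonzero homogeneous `w`; a projection `μμ*` isolates one
basis vector of its support, which generates. Homogeneity is essential: elements of `L_x` with one
codomain and different degrees cannot be separated by any `μμ*`. -/
lemma isGradedSimple (p : InfPath G) (m : ℤ) :
    IsGradedSimple (act K (.inf p)) (gr K (.inf p) m) where
  toIsGradedModule := isGradedModule m
  nontrivial := by
    refine ⟨of K ⟨Arrow.unit _, rfl⟩, 0, fun h => ?_⟩
    have := coeff_of_self (K := K) (x := .inf p) ⟨Arrow.unit _, rfl⟩
    rw [h, map_zero] at this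
    exact zero_ne_one this
  eq_bot_or_eq_top P hP hgr := by
    by_cases h : ∀ j, P ⊓ gr K (.inf p) m j = ⊥
    · left
      rw [hgr]
      simp [h]
    right
    push Not at h
    obtain ⟨j, hj⟩ := h
    obtain ⟨w, ⟨hwP, hwj⟩, hw0⟩ := Submodule.exists_mem_ne_zero_of_ne_bot hj
    obtain ⟨t, ht⟩ : ∃ t, coeff t w ≠ 0 := by
      by_contra! h
      exact hw0 (ext_coeff fun t => by rw [h, map_zero])
    have htail := t.1.tail
    rw [t.2] at htail
    obtain ⟨q, hq⟩ := htail.exists_eq_inf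
    -- Only the codomains of the support of `w` other than `q` have to be excluded.
    obtain ⟨μ, hμ, hS⟩ := BPath.exists_separating_prefix q
      (((fun s : LSet (BPath.inf p) => s.1.cod) '' {s | coeff s w ≠ 0}) \ {.inf q})
      (((finite_coeff_ne_zero w).image _).sdiff) (fun h => h.2 rfl)
    rw [← hq] at hμ
    have key : act K (.inf p) (LeavittPathAlgebra.monomial K μ μ) w = coeff t w • of K t := by
      refine ext_coeff fun s => ?_
      change coeff s (lpaAct K _ _ w) = _
      rw [map_smul]
      by_cases hst : s = t
      · rw [hst, coeff_lpaAct_monomial_self μ t w hμ, coeff_of_self, smul_eq_mul, mul_one]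
      · rw [coeff_of_ne hst, smul_zero]
        by_cases hs : coeff s w = 0
        · by_cases hsμ : ∃ (r : BPath G) (h : μ.range = r.src), s.1.cod = BPath.prepend μ r h
          · rw [coeff_lpaAct_monomial_self μ s w hsμ, hs]
          · exact coeff_lpaAct_monomial_self_eq_zero μ s w fun r h e => hsμ ⟨r, h, e⟩
        · refine coeff_lpaAct_monomial_self_eq_zero μ s w (hS _ ⟨⟨s, hs, rfl⟩, ?_⟩)
          intro e
          -- Two elements of the support of `w` have the same degree, so equal codomains would make
          -- them equal.
          refine hst (LSet.ext (e.trans hq.symm) ?_)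
          rw [deg_of_mem_gr hwj hs, deg_of_mem_gr hwj ht]
    refine eq_top_of_of_mem hP (t := t) ?_
    have := P.smul_mem (coeff t w)⁻¹ (key ▸ hP _ w hwP)
    rwa [smul_smul, inv_mul_cancel₀ ht, one_smul] at this

end KL

/-! ### Homomorphisms of graded modules -/

section Graded

variable {K : Type*} [Field K]
variable {M : Type*} [AddCommGroup M] [Module K M] {gr : ℤ → Submodule K M}
variable {M' : Type*} [AddCommGroup M'] [Module K M'] {gr' : ℤ → Submodule K M'}
variable {M'' : Type*} [AddCommGroup M''] [Module K M''] {gr'' : ℤ → Submodule K M''}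

open DirectSum in
/-- A linear map of degree zero commutes with taking homogeneous components. -/
lemma map_decompose [Decomposition gr] [Decomposition gr'] {f : M →ₗ[K] M'}
    (hf : ∀ j, ∀ u ∈ gr j, f u ∈ gr' j) (u : M) (j : ℤ) :
    f (decompose gr u j) = decompose gr' (f u) j := by
  induction u using Decomposition.inductionOn gr with
  | zero => simp
  | @homogeneous i u =>
    by_cases h : i = j
    · subst h
      rw [decompose_of_mem_same _ u.2, decompose_of_mem_same _ (hf i u u.2)]
    · rw [decompose_of_mem_ne _ u.2 h, decompose_of_mem_ne _ (hf i u u.2) h, map_zero]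
  | add u v hu hv =>
    rw [decompose_add, map_add, decompose_add]
    simp only [DirectSum.add_apply, Submodule.coe_add, map_add, hu, hv]

-- `GradedIso` asks for an equivalence of memberships. If `f u` has degree `j`, its other components
-- vanish, and injectivity kills those of `u`.
open DirectSum in
lemma mem_iff_of_injective (h : IsInternal gr) (h' : IsInternal gr') {f : M →ₗ[K] M'}
    (hf : ∀ j, ∀ u ∈ gr j, f u ∈ gr' j) (hinj : Function.Injective f) (j : ℤ) (u : M) :
    u ∈ gr j ↔ f u ∈ gr' j := by
  classical
  let := h.chooseDecomposition gr
  let := h'.chooseDecomposition gr'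
  refine ⟨hf j u, fun hu => ?_⟩
  rw [← sum_support_decompose gr u]
  refine Submodule.sum_mem _ fun i _ => ?_
  by_cases hi : j = i
  · subst hi
    exact (decompose gr u j).2
  · have : (decompose gr u i : M) = 0 := by
      apply hinj
      rw [map_decompose hf, decompose_of_mem_ne _ hu hi, map_zero]
    rw [this]
    exact zero_mem _

-- A map of degree zero commutes with components, so the components of a kernel element are again in
-- the kernel. The form is that demanded of graded submodules in `IsGradedSimple`.
open DirectSum in
lemma ker_eq_iSup (h : IsInternal gr) (h' : IsInternal gr') {f : M →ₗ[K] M'}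
    (hf : ∀ j, ∀ u ∈ gr j, f u ∈ gr' j) :
    LinearMap.ker f = ⨆ j, LinearMap.ker f ⊓ gr j := by
  classical
  let := h.chooseDecomposition gr
  let := h'.chooseDecomposition gr'
  refine le_antisymm (fun u hu => ?_) (iSup_le fun j => inf_le_left)
  rw [← sum_support_decompose gr u]
  refine Submodule.sum_mem _ fun i _ => Submodule.mem_iSup_of_mem i ⟨?_, (decompose gr u i).2⟩
  rw [SetLike.mem_coe, LinearMap.mem_ker, map_decompose hf, LinearMap.mem_ker.1 hu]
  simp

lemma range_eq_iSup (h : DirectSum.IsInternal gr) {f : M →ₗ[K] M'}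
    (hf : ∀ j, ∀ u ∈ gr j, f u ∈ gr' j) :
    LinearMap.range f = ⨆ j, LinearMap.range f ⊓ gr' j := by
  refine le_antisymm ?_ (iSup_le fun j => inf_le_left)
  conv_lhs => rw [LinearMap.range_eq_map, ← h.submodule_iSup_eq_top, Submodule.map_iSup]
  refine iSup_mono fun j => ?_
  rintro _ ⟨u, hu, rfl⟩
  exact ⟨⟨u, rfl⟩, hf j u hu⟩

variable {act : LeavittPathAlgebra K G →ₙₐ[K] Module.End K M}
variable {act' : LeavittPathAlgebra K G →ₙₐ[K] Module.End K M'}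
variable {act'' : LeavittPathAlgebra K G →ₙₐ[K] Module.End K M''}

lemma GradedIso.symm : GradedIso act gr act' gr' → GradedIso act' gr' act gr := by
  rintro ⟨f, h1, h2⟩
  refine ⟨f.symm, fun a u => ?_, fun j u => ?_⟩
  · rw [LinearEquiv.symm_apply_eq, h1, LinearEquiv.apply_symm_apply]
  · rw [h2, LinearEquiv.apply_symm_apply]

lemma GradedIso.trans : GradedIso act gr act' gr' → GradedIso act' gr' act'' gr'' →
    GradedIso act gr act'' gr'' := by
  rintro ⟨f, h1, h2⟩ ⟨f', h1', h2'⟩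
  exact ⟨f.trans f', fun a u => by simp [h1, h1'], fun j u => (h2 j u).trans (h2' j (f u))⟩

/-- Graded simplicity is invariant under graded isomorphism. -/
lemma IsGradedSimple.of_gradedIso (h : IsGradedSimple act gr) (e : GradedIso act gr act' gr') :
    IsGradedSimple act' gr' := by
  obtain ⟨f, hact, hgr⟩ := e
  -- The induced isomorphism of submodule lattices matches the components, so independence, suprema
  -- and the condition on graded submodules all transport along it.
  have hmap : ∀ j, Submodule.orderIsoMapComap f (gr j) = gr' j := by
    intro j
    ext u
    constructor
    · rintro ⟨v, hv, rfl⟩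
      exact (hgr j v).1 hv
    · intro hu
      exact ⟨f.symm u, (hgr j _).2 (by rwa [f.apply_symm_apply]), f.apply_symm_apply u⟩
  have hact' : ∀ a u, f.symm (act' a u) = act a (f.symm u) := fun a u => by
    rw [LinearEquiv.symm_apply_eq, hact, f.apply_symm_apply]
  refine ⟨⟨?_, ?_, ?_⟩, ?_, ?_⟩
  · rw [eq_top_iff]
    intro u _
    have hu : f.symm u ∈ Submodule.span K {w : M | ∃ a u, w = act a u} := h.unital ▸ trivial
    have hle : Submodule.span K {w : M | ∃ a u, w = act a u} ≤
        (Submodule.span K {w : M' | ∃ a u, w = act' a u}).comap (f : M →ₗ[K] M') := by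
      rw [Submodule.span_le]
      rintro _ ⟨a, v, rfl⟩
      exact Submodule.subset_span ⟨a, f v, hact a v⟩
    simpa using hle hu
  · rw [DirectSum.isInternal_submodule_iff_iSupIndep_and_iSup_eq_top]
    have hfun : gr' = Submodule.orderIsoMapComap f ∘ gr := funext fun j => (hmap j).symm
    constructor
    · rw [hfun]
      exact h.internal.submodule_iSupIndep.map_orderIso _
    · rw [hfun]
      change ⨆ j, Submodule.orderIsoMapComap f (gr j) = ⊤
      rw [← OrderIso.map_iSup, h.internal.submodule_iSup_eq_top, OrderIso.map_top]
  · intro i j a ha u hu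
    have h1 := h.act_mem i j a ha (f.symm u) ((hgr j _).2 (by rwa [f.apply_symm_apply]))
    rwa [hgr, hact, f.apply_symm_apply] at h1
  · have := h.nontrivial
    exact f.symm.toEquiv.nontrivial
  · intro P hP hPgr
    have hP' := h.eq_bot_or_eq_top ((Submodule.orderIsoMapComap f).symm P)
      (fun a u hu => by
        change f (act a u) ∈ P
        rw [hact]
        exact hP a (f u) hu)
      (by
        conv_lhs => rw [hPgr]
        rw [OrderIso.map_iSup]
        simp only [OrderIso.map_inf, ← hmap, OrderIso.symm_apply_apply])
    rcases hP' with h0 | h1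
    · left
      rw [← OrderIso.apply_symm_apply (Submodule.orderIsoMapComap f) P, h0, OrderIso.map_bot]
    · right
      rw [← OrderIso.apply_symm_apply (Submodule.orderIsoMapComap f) P, h1, OrderIso.map_top]

/-- Schur's lemma for graded simple modules. -/
lemma IsGradedSimple.gradedIso_of_ne_zero (h : IsGradedSimple act gr)
    (h' : IsGradedSimple act' gr') (f : M →ₗ[K] M') (hact : ∀ a u, f (act a u) = act' a (f u))
    (hgr : ∀ j, ∀ u ∈ gr j, f u ∈ gr' j) (hf : f ≠ 0) : GradedIso act gr act' gr' := by
  -- Kernel and range are graded submodules; `f ≠ 0` rules out kernel `⊤` and range `⊥`.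
  have hinj : LinearMap.ker f = ⊥ := by
    refine (h.eq_bot_or_eq_top _ (fun a u hu => ?_)
      (ker_eq_iSup h.internal h'.internal hgr)).resolve_right
      fun e => hf (LinearMap.ker_eq_top.1 e)
    rw [LinearMap.mem_ker, hact, LinearMap.mem_ker.1 hu, map_zero]
  have hsurj : LinearMap.range f = ⊤ := by
    refine (h'.eq_bot_or_eq_top _ ?_ (range_eq_iSup h.internal hgr)).resolve_left
      fun e => hf (LinearMap.range_eq_bot.1 e)
    rintro a _ ⟨u, rfl⟩
    exact ⟨act a u, hact a u⟩
  have hinj' := LinearMap.ker_eq_bot.1 hinj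
  exact ⟨LinearEquiv.ofBijective f ⟨hinj', LinearMap.range_eq_top.1 hsurj⟩, hact,
    mem_iff_of_injective h.internal h'.internal hgr hinj'⟩

/-- A linear map that commutes with the action of the generators is a homomorphism of modules over
the Leavitt path algebra. -/
lemma map_act_of_gen (f : M →ₗ[K] M')
    (hf : ∀ g u, f (act (LeavittPathAlgebra.gen K g) u) =
      act' (LeavittPathAlgebra.gen K g) (f u)) (a : LeavittPathAlgebra K G) (u : M) :
    f (act a u) = act' a (f u) := by
  obtain ⟨a, ha⟩ := a
  induction ha using NonUnitalAlgebra.adjoin_induction generalizing u with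
  | mem a ha =>
    obtain ⟨g, rfl⟩ := ha
    exact hf g u
  | add a b ha hb iha ihb =>
    change f (act (⟨a, ha⟩ + ⟨b, hb⟩) u) = act' (⟨a, ha⟩ + ⟨b, hb⟩) (f u)
    rw [map_add, map_add, LinearMap.add_apply, map_add, iha, ihb, LinearMap.add_apply]
  | zero =>
    change f (act 0 u) = act' 0 (f u)
    rw [map_zero, map_zero, LinearMap.zero_apply, map_zero, LinearMap.zero_apply]
  | mul a b ha hb iha ihb =>
    change f (act (⟨a, ha⟩ * ⟨b, hb⟩) u) = act' (⟨a, ha⟩ * ⟨b, hb⟩) (f u)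
    rw [map_mul, map_mul, Module.End.mul_apply, Module.End.mul_apply, iha, ihb]
  | smul k a ha iha =>
    change f (act (k • ⟨a, ha⟩) u) = act' (k • ⟨a, ha⟩) (f u)
    rw [map_smul, map_smul, LinearMap.smul_apply, LinearMap.smul_apply, map_smul, iha]

end Graded

/-! ### The module `K[tⁿ, t⁻ⁿ]` is free of rank one -/

namespace LaurentMod

variable (K : Type*) [Field K] (c : SimpleClosedPath G)

/-- The Laurent polynomial `1`. -/
def one : LaurentMod K c := (1 : laurentSub K c.length)

variable {K c}

lemma toLaurent_injective : Function.Injective (toLaurent K c) := Subtype.val_injective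

lemma toLaurent_smul (a : IsoAlg K c.infPow) (f : LaurentMod K c) :
    toLaurent K c (a • f) = (isoToLaurent K c a : K[T;T⁻¹]) * toLaurent K c f := rfl

lemma toLaurent_smul_one (a : IsoAlg K c.infPow) :
    toLaurent K c (a • one K c) = (isoToLaurent K c a : K[T;T⁻¹]) := by
  rw [toLaurent_smul]
  exact mul_one _

lemma isoToLaurent_single (g : Isotropy c.infPow) (a : K) :
    (isoToLaurent K c (MonoidAlgebra.single g a) : K[T;T⁻¹]) =
      a • LaurentPolynomial.T g.deg := by
  rw [isoToLaurent, MonoidAlgebra.lift_single]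
  rfl

/-- The degree is injective on the isotropy group, so distinct group elements go to distinct powers
of `t` and no coefficients merge. -/
lemma coeff_isoToLaurent (a : IsoAlg K c.infPow) (g : Isotropy c.infPow) :
    (isoToLaurent K c a : K[T;T⁻¹]).coeff g.deg = a.coeff g := by
  induction a using MonoidAlgebra.induction_linear with
  | zero => simp
  | add a b ha hb =>
    rw [map_add, MonoidAlgebra.coeff_add, Finsupp.add_apply, ← ha, ← hb]
    rfl
  | single h r =>
    rw [isoToLaurent_single, MonoidAlgebra.coeff_single, AddMonoidAlgebra.coeff_smul,
      Finsupp.smul_apply, LaurentPolynomial.T_apply]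
    by_cases e : h = g
    · subst e
      simp
    · rw [Finsupp.single_eq_of_ne (Ne.symm e), if_neg fun e' => e (Isotropy.ext e'), smul_zero]

lemma isoToLaurent_injective : Function.Injective (isoToLaurent K c) := by
  intro a b h
  refine MonoidAlgebra.coeff_injective (Finsupp.ext fun g => ?_)
  rw [← coeff_isoToLaurent, ← coeff_isoToLaurent, h]

lemma exists_isotropy_deg_eq {k : ℤ} (h : (c.length : ℤ) ∣ k) :
    ∃ g : Isotropy c.infPow, g.deg = k := by
  obtain ⟨q, rfl⟩ := h
  rw [mul_comm]
  exact ⟨⟨⟨_, _, _, c.tailEquiv_infPow_mul_length q⟩, rfl, rfl⟩, rfl⟩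

/-- The image is a subalgebra containing both generators, since the degrees `±|c|` occur in the
isotropy group. -/
lemma isoToLaurent_surjective : Function.Surjective (isoToLaurent K c) := by
  have hle : laurentSub K c.length ≤
      ((laurentSub K c.length).val.comp (isoToLaurent K c)).range := by
    refine Algebra.adjoin_le ?_
    have key : ∀ k : ℤ, (c.length : ℤ) ∣ k → (LaurentPolynomial.T k : K[T;T⁻¹]) ∈
        ((laurentSub K c.length).val.comp (isoToLaurent K c)).range := by
      intro k hk
      obtain ⟨g, rfl⟩ := exists_isotropy_deg_eq hk
      exact ⟨MonoidAlgebra.single g 1, (isoToLaurent_single g 1).trans (one_smul _ _)⟩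
    rintro _ (rfl | rfl)
    · exact key _ dvd_rfl
    · exact key _ (dvd_neg.2 dvd_rfl)
  intro f
  obtain ⟨a, ha⟩ := hle f.2
  exact ⟨a, Subtype.ext ha⟩

variable (K c) in
/-- `K[tⁿ, t⁻ⁿ]` is free of rank one over the group algebra of the isotropy group. -/
def equivIsoAlg : IsoAlg K c.infPow ≃ₗ[IsoAlg K c.infPow] LaurentMod K c :=
  LinearEquiv.ofBijective (LinearMap.toSpanSingleton (IsoAlg K c.infPow) (LaurentMod K c) (one K c))
    ⟨fun a b h => isoToLaurent_injective (Subtype.ext (by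
        rw [← toLaurent_smul_one, ← toLaurent_smul_one]
        exact congrArg _ h)),
      fun f => by
        obtain ⟨a, ha⟩ := isoToLaurent_surjective f
        refine ⟨a, toLaurent_injective ((toLaurent_smul_one a).trans ?_)⟩
        rw [ha]
        rfl⟩

lemma equivIsoAlg_apply (a : IsoAlg K c.infPow) : equivIsoAlg K c a = a • one K c := rfl

variable (K c) in
/-- The basis of `K[tⁿ, t⁻ⁿ]` consisting of the powers of `t`. -/
def basis : Module.Basis (Isotropy c.infPow) K (LaurentMod K c) :=
  (MonoidAlgebra.basis (Isotropy c.infPow) K).map ((equivIsoAlg K c).restrictScalars K)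

lemma basis_apply (g : Isotropy c.infPow) :
    basis K c g = (MonoidAlgebra.single g 1 : IsoAlg K c.infPow) • one K c := by
  rw [basis, Module.Basis.map_apply, MonoidAlgebra.basis_apply]
  rfl

lemma toLaurent_basis (g : Isotropy c.infPow) :
    toLaurent K c (basis K c g) = LaurentPolynomial.T g.deg := by
  rw [basis_apply, toLaurent_smul_one, isoToLaurent_single, one_smul]

lemma coeff_toLaurent (f : LaurentMod K c) (g : Isotropy c.infPow) :
    (toLaurent K c f).coeff g.deg = (basis K c).repr f g := by
  obtain ⟨a, rfl⟩ := (equivIsoAlg K c).surjective f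
  rw [equivIsoAlg_apply, toLaurent_smul_one, coeff_isoToLaurent, ← equivIsoAlg_apply, basis]
  simp [MonoidAlgebra.basis]

/-- Puts the grading in the form required by `isInternal_span_basis`. When `|c|` does not divide
`j`, no `g` has degree `j` and both sides vanish. -/
lemma gr_eq_span (j : ℤ) : gr K c j = Submodule.span K {w | ∃ g, g.deg = j ∧ w = basis K c g} := by
  refine le_antisymm (fun f hf => ?_) (Submodule.span_le.2 ?_)
  · obtain ⟨a, ha⟩ := Submodule.mem_span_singleton.1 (show toLaurent K c f ∈ _ from hf)
    rw [← (basis K c).linearCombination_repr f, Finsupp.linearCombination_apply]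
    refine Submodule.sum_mem _ fun g _ => ?_
    by_cases hg : g.deg = j
    · exact Submodule.smul_mem _ _ (Submodule.subset_span ⟨g, hg, rfl⟩)
    · have : (basis K c).repr f g = 0 := by
        rw [← coeff_toLaurent, ← ha, AddMonoidAlgebra.coeff_smul, Finsupp.smul_apply,
          LaurentPolynomial.T_apply, if_neg (Ne.symm hg), smul_zero]
      simp only [this, zero_smul]
      exact zero_mem _
  · rintro _ ⟨g, rfl, rfl⟩
    change toLaurent K c (basis K c g) ∈ Submodule.span K {LaurentPolynomial.T g.deg}
    rw [toLaurent_basis]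
    exact Submodule.mem_span_singleton_self _

lemma isGradedIsoModule_shift (m : ℤ) : IsGradedIsoModule K c.infPow (shift (gr K c) m) where
  internal := by
    -- Shifting by `m` lowers the degree of each basis vector by `m`.
    have := isInternal_span_basis (basis K c) fun g => g.deg - m
    simp only [sub_eq_iff_eq_add, ← gr_eq_span] at this
    exact this
  smul_mem i j a ha u hu := by
    have hle : isoHomogeneous K c.infPow i ≤
        (gr K c (i + j + m)).comap ((LinearMap.toSpanSingleton (IsoAlg K c.infPow)
          (LaurentMod K c) u).restrictScalars K) := by
      rw [isoHomogeneous, Submodule.span_le]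
      rintro _ ⟨g, rfl, rfl⟩
      obtain ⟨b, hb⟩ := Submodule.mem_span_singleton.1 (show toLaurent K c u ∈ _ from hu)
      change toLaurent K c ((MonoidAlgebra.single g 1 : IsoAlg K c.infPow) • u) ∈
        Submodule.span K {LaurentPolynomial.T (g.deg + j + m)}
      rw [toLaurent_smul, ← hb, isoToLaurent_single, one_smul, mul_smul_comm,
        ← LaurentPolynomial.T_add, ← add_assoc]
      exact Submodule.smul_mem _ _ (Submodule.mem_span_singleton_self _)
    exact hle ha

end LaurentMod

/-! ### Induced modules and `K L_x` -/

section Ind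

variable {K : Type*} [Field K] {x : BPath G}

lemma KL.single_smul_of (g : Isotropy x) (t : LSet x) :
    (MonoidAlgebra.single g 1 : IsoAlg K x) • of K t = of K (t.mulIso g) := by
  rw [single_smul, one_smul, isoEnd_of]

variable (K) in
/-- The module induced from `K[tⁿ, t⁻ⁿ]` is `K L_x` for `x = c^∞`. -/
def indLaurentEquiv (c : SimpleClosedPath G) :
    Ind K c.infPow (LaurentMod K c) ≃ₗ[K] KL K c.infPow :=
  ((TensorProduct.congr (LinearEquiv.refl (IsoAlg K c.infPow) (KL K c.infPow))
    (LaurentMod.equivIsoAlg K c).symm).trans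
      (TensorProduct.rid (IsoAlg K c.infPow) (KL K c.infPow))).restrictScalars K

lemma indLaurentEquiv_tmul (c : SimpleClosedPath G) (w : KL K c.infPow) (f : LaurentMod K c) :
    indLaurentEquiv K c (w ⊗ₜ f) = (LaurentMod.equivIsoAlg K c).symm f • w := by
  simp [indLaurentEquiv]

lemma indLaurentEquiv_tmul_basis (c : SimpleClosedPath G) (t : LSet c.infPow)
    (g : Isotropy c.infPow) :
    indLaurentEquiv K c (KL.of K t ⊗ₜ LaurentMod.basis K c g) = KL.of K (t.mulIso g) := by
  rw [indLaurentEquiv_tmul, LaurentMod.basis_apply, ← LaurentMod.equivIsoAlg_apply,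
    LinearEquiv.symm_apply_apply, KL.single_smul_of]

/-- Tensoring with a free module of rank one changes nothing, and `t ⊗ t^k` corresponds to `t`
composed with the isotropy element of degree `k`, so the gradings match. -/
lemma gradedIso_indLaurent (c : SimpleClosedPath G) (m : ℤ) :
    GradedIso (indAct K c.infPow (LaurentMod K c))
      (indGr K c.infPow (shift (LaurentMod.gr K c) m))
      (KL.act K c.infPow) (KL.gr K c.infPow m) := by
  refine ⟨indLaurentEquiv K c, fun a u => ?_, fun k u => ?_⟩
  · induction u using TensorProduct.induction_on with
    | zero => simp
    | add u v hu hv => rw [map_add, map_add, hu, hv, map_add, map_add]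
    | tmul w f =>
      rw [indAct_tmul, indLaurentEquiv_tmul, indLaurentEquiv_tmul]
      exact (map_smul (KL.lpaAct K c.infPow a) _ w).symm
  · have h1 : indGr K c.infPow (shift (LaurentMod.gr K c) m) k ≤
        (KL.gr K c.infPow m k).comap (indLaurentEquiv K c : _ →ₗ[K] _) := by
      rw [indGr, Submodule.span_le]
      rintro _ ⟨t, j, f, hf, hd, rfl⟩
      rw [shift, LaurentMod.gr_eq_span] at hf
      have hle : Submodule.span K {w | ∃ g, g.deg = j + m ∧ w = LaurentMod.basis K c g} ≤
          (KL.gr K c.infPow m k).comap ((indLaurentEquiv K c : _ →ₗ[K] _).comp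
            ((TensorProduct.mk (IsoAlg K c.infPow) (KL K c.infPow) (LaurentMod K c)
              (KL.of K t)).restrictScalars K)) := by
        rw [Submodule.span_le]
        rintro _ ⟨g, hg, rfl⟩
        change indLaurentEquiv K c (KL.of K t ⊗ₜ LaurentMod.basis K c g) ∈ KL.gr K c.infPow m k
        rw [indLaurentEquiv_tmul_basis]
        refine KL.of_mem_gr ?_
        change t.1.deg + g.deg = k + m
        omega
      exact hle hf
    have h2 : KL.gr K c.infPow m k ≤ (indGr K c.infPow (shift (LaurentMod.gr K c) m) k).comap
        ((indLaurentEquiv K c).symm : _ →ₗ[K] _) := by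
      rw [KL.gr, Submodule.span_le]
      rintro _ ⟨t, ht, rfl⟩
      have e : (indLaurentEquiv K c).symm (KL.of K t) =
          KL.of K t ⊗ₜ LaurentMod.basis K c 1 := by
        rw [LinearEquiv.symm_apply_eq, indLaurentEquiv_tmul_basis]
        exact congrArg _ (LSet.ext rfl (add_zero _).symm)
      change (indLaurentEquiv K c).symm (KL.of K t) ∈ indGr K c.infPow _ k
      rw [e]
      -- The Laurent polynomial `1` has degree `-m` in the shifted grading.
      refine Submodule.subset_span ⟨t, -m, _, ?_, by omega, rfl⟩
      rw [shift, LaurentMod.gr_eq_span, neg_add_cancel]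
      exact Submodule.subset_span ⟨1, rfl, rfl⟩
    exact ⟨fun hu => h1 hu, fun hu => by simpa using h2 hu⟩

/-- Shifts of `K L_x` and `K L_y`, for infinite paths `x` and `y`, can be graded isomorphic only if
`x` and `y` are tail-equivalent with lag the difference of the shifts. -/
lemma KL.exists_tailEquiv_of_gradedIso {p q : InfPath G} {m m' : ℤ}
    (h : GradedIso (KL.act K (.inf p)) (KL.gr K (.inf p) m) (KL.act K (.inf q))
      (KL.gr K (.inf q) m')) : TailEquiv (.inf p) (m' - m) (.inf q) := by
  obtain ⟨f, hact, hgr⟩ := h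
  obtain ⟨t, ht⟩ : ∃ t : LSet (.inf p), t.1 = Arrow.unit (.inf p) := ⟨⟨_, rfl⟩, rfl⟩
  have hf0 : f (of K t) ≠ 0 := by
    intro h
    have h1 := coeff_of_self (K := K) t
    rw [(LinearEquiv.map_eq_zero_iff f).1 h, map_zero] at h1
    exact zero_ne_one h1
  have hdeg : f (of K t) ∈ gr K (.inf q) m' (-m) := by
    rw [← hgr]
    refine of_mem_gr ?_
    rw [ht, neg_add_cancel]
    rfl
  obtain ⟨s, hs⟩ : ∃ s, coeff s (f (of K t)) ≠ 0 := by
    by_contra! h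
    exact hf0 (ext_coeff fun s => by rw [h, map_zero])
  -- Otherwise some prefix `μ` of `p` is not a prefix of the codomain of `s`. Then `μμ*` fixes the
  -- unit at `p`, hence its image, but annihilates the coefficient at `s`.
  have hcod : s.1.cod = .inf p := by
    by_contra hne
    obtain ⟨μ, hμ, hS⟩ := BPath.exists_separating_prefix p {s.1.cod} (Set.finite_singleton _)
      fun h => hne (Set.mem_singleton_iff.1 h).symm
    have hfix : act K (.inf p) (LeavittPathAlgebra.monomial K μ μ) (of K t) = of K t :=
      lpaAct_monomial_self_of (by rw [ht]; exact hμ)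
    apply hs
    rw [← hfix, hact]
    exact coeff_lpaAct_monomial_self_eq_zero μ s _ (hS _ rfl)
  have htail := s.1.tail
  rw [hcod, s.2, deg_of_mem_gr hdeg hs] at htail
  rwa [show m' - m = -m + m' by ring]

/-! ### Homomorphisms from `K L_x` to induced modules -/

/-- The composition of an element of `L_y` with an arrow from `x` to `y`. -/
def LSet.compRight {y : BPath G} (t : LSet y) (g : Arrow G) (hy : g.cod = y) (hx : g.dom = x) :
    LSet x :=
  ⟨t.1.comp g (t.2.trans hy.symm), hx⟩

/-- Cylinders act on the codomain and composition with `g` changes the domain, so the two commute by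
associativity of addition of degrees. -/
lemma KL.cylAct_extend_compRight {y : BPath G} (g : Arrow G) (hy : g.cod = y) (hx : g.dom = x)
    (μ ν : FinPath G) (w : KL K y) :
    extend (fun t => of K (t.compRight g hy hx)) (cylAct μ ν w) =
      cylAct μ ν (extend (fun t => of K (t.compRight g hy hx)) w) := by
  refine LinearMap.congr_fun (hom_ext (f := (extend fun t : LSet y =>
    of K (t.compRight g hy hx)).comp (cylAct μ ν)) (g := (cylAct μ ν).comp
      (extend fun t : LSet y => of K (t.compRight g hy hx))) fun t => ?_) w
  rw [LinearMap.comp_apply, LinearMap.comp_apply, extend_of]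
  by_cases h : ∃ (p : BPath G) (_ : μ.range = p.src) (hν : ν.range = p.src),
      t.1.cod = BPath.prepend ν p hν
  · obtain ⟨p, hμ, hν, ht⟩ := h
    obtain ⟨u, hu, hd, hut⟩ := exists_cylAct_of (K := K) p hμ hν ht
    rw [hut, extend_of]
    refine (cylAct_of p hμ hν (t := t.compRight g hy hx) ht _ hu ?_).symm
    change u.1.deg + g.deg = (μ.length : ℤ) - ν.length + (t.1.deg + g.deg)
    rw [hd, add_assoc]
  · have h' : ∀ (p : BPath G), μ.range = p.src → ∀ hν : ν.range = p.src,
        t.1.cod ≠ BPath.prepend ν p hν := fun p h1 h2 h3 => h ⟨p, h1, h2, h3⟩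
    rw [cylAct_of_eq_zero h', cylAct_of_eq_zero (t := t.compRight g hy hx) h', map_zero]

variable {N : Type*} [AddCommGroup N] [Module (IsoAlg K x) N]

variable (K) in
/-- The homomorphism `K L_y → Ind_x(N)`, `t ↦ t g ⊗ u`, for an arrow `g` from `x` to `y` and
`u ∈ N`. -/
def toInd {y : BPath G} (g : Arrow G) (hy : g.cod = y) (hx : g.dom = x) (u : N) :
    KL K y →ₗ[K] Ind K x N :=
  (((TensorProduct.mk (IsoAlg K x) (KL K x) N).flip u).restrictScalars K).comp
    (KL.extend fun t => KL.of K (t.compRight g hy hx))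

lemma toInd_of {y : BPath G} (g : Arrow G) (hy : g.cod = y) (hx : g.dom = x) (u : N)
    (t : LSet y) : toInd K g hy hx u (KL.of K t) = KL.of K (t.compRight g hy hx) ⊗ₜ u := by
  rw [toInd, LinearMap.comp_apply, KL.extend_of]
  rfl

/-- It suffices to treat generators, each of which acts by a cylinder. -/
lemma toInd_act {y : BPath G} (g : Arrow G) (hy : g.cod = y) (hx : g.dom = x) (u : N)
    (a : LeavittPathAlgebra K G) (w : KL K y) :
    toInd K g hy hx u (KL.act K y a w) = indAct K x N a (toInd K g hy hx u w) := by
  refine map_act_of_gen _ (fun γ w => ?_) a w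
  have key : KL.extend (fun t => KL.of K (t.compRight g hy hx))
      (KL.lpaAct K y (LeavittPathAlgebra.gen K γ) w) =
      KL.lpaAct K x (LeavittPathAlgebra.gen K γ)
        (KL.extend (fun t => KL.of K (t.compRight g hy hx)) w) := by
    rw [KL.lpaAct_gen, KL.lpaAct_gen]
    cases γ <;> exact KL.cylAct_extend_compRight g hy hx _ _ w
  exact congrArg (fun v => v ⊗ₜ[IsoAlg K x] u) key

end Ind

/-- A graded simple module induced from an isotropy group at `x` is a shift of `K L_y`, for every
infinite path `y` tail-equivalent to `x`. -/
lemma exists_gradedIso_KL {K : Type*} [Field K] {x : BPath G} {N : Type*} [AddCommGroup N]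
    [Module K N] [Module (IsoAlg K x) N] {gr : ℤ → Submodule K N}
    (h : IsGradedSimple (indAct K x N) (indGr K x gr)) {p : InfPath G} {k : ℤ}
    (hp : TailEquiv (.inf p) k x) :
    ∃ d : ℤ, ∀ l : ℤ, TailEquiv (.inf p) l (.inf p) → GradedIso (indAct K x N) (indGr K x gr)
      (KL.act K (.inf p)) (KL.gr K (.inf p) (d + l)) := by
  -- The tensors `t ⊗ u` with `u` homogeneous span all components, so they cannot all vanish.
  have hne : ∃ (t : LSet x) (j : ℤ) (u : N), u ∈ gr j ∧ KL.of K t ⊗ₜ[IsoAlg K x] u ≠ 0 := by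
    by_contra! h0
    obtain ⟨w, hw⟩ := @exists_ne _ h.nontrivial (0 : Ind K x N)
    have hbot : ∀ j, indGr K x gr j = ⊥ := by
      intro j
      rw [indGr, Submodule.span_eq_bot]
      rintro _ ⟨t, i, u, hu, -, rfl⟩
      exact h0 t i u hu
    have htop := h.internal.submodule_iSup_eq_top
    rw [show indGr K x gr = fun _ => ⊥ from funext hbot, iSup_bot] at htop
    have : w ∈ (⊥ : Submodule K (Ind K x N)) := htop ▸ trivial
    exact hw this
  obtain ⟨t, j, u, hu, htu⟩ := hne
  -- The arrow `g` below has degree `k - l`, so `s ↦ sg ⊗ u` raises degrees by `k - l + j`; the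
  -- shift `-(k + j) + l` compensates for this.
  refine ⟨-(k + j), fun l hl => GradedIso.symm ?_⟩
  let g : Arrow G := ⟨_, _, _, hl.symm.trans hp⟩
  refine (KL.isGradedSimple p _).gradedIso_of_ne_zero h (toInd K g rfl rfl u)
    (toInd_act g rfl rfl u) (fun i w hw => ?_) fun h0 => htu ?_
  · have hle : KL.gr K (.inf p) (-(k + j) + l) i ≤
        (indGr K x gr i).comap (toInd K g rfl rfl u) := by
      rw [KL.gr, Submodule.span_le]
      rintro _ ⟨s, hs, rfl⟩
      change toInd K g rfl rfl u (KL.of K s) ∈ indGr K x gr i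
      rw [toInd_of]
      refine Submodule.subset_span ⟨_, j, u, hu, ?_, rfl⟩
      change s.1.deg + (-l + k) + j = i
      omega
    exact hle hw
  -- The map is nonzero because `t = (t g⁻¹) g` puts `t ⊗ u` in its range.
  · have e : (LSet.compRight (x := .inf p) t g.inv rfl rfl).compRight g rfl rfl = t :=
      LSet.ext rfl (by
        change t.1.deg + -g.deg + g.deg = t.1.deg
        ring)
    rw [← e, ← toInd_of, h0, LinearMap.zero_apply]

end LPA

end

/-! ### The classification -/

theorem proposition4p18 {V W K : Type*} [Field K] (G : LPA.DirectedGraph V W)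
    (C : Set (LPA.SimpleClosedPath G))
    (hC : ∀ d : LPA.SimpleClosedPath G, ∃! c : LPA.SimpleClosedPath G, c ∈ C ∧ c.IsRotation d) :
    -- every module in the list is a graded simple module induced from the isotropy group of a
    -- rational path
    (∀ c ∈ C, ∀ m : ℕ, m < c.length →
      LPA.IsRational c.infPow ∧
      LPA.IsGradedIsoModule K c.infPow (LPA.shift (LPA.LaurentMod.gr K c) m) ∧
      LPA.IsGradedSimple (LPA.indAct K c.infPow (LPA.LaurentMod K c))
        (LPA.indGr K c.infPow (LPA.shift (LPA.LaurentMod.gr K c) m))) ∧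
    -- the modules in the list are pairwise non-isomorphic
    (∀ c ∈ C, ∀ m : ℕ, m < c.length → ∀ c' ∈ C, ∀ m' : ℕ, m' < c'.length →
      LPA.GradedIso (LPA.indAct K c.infPow (LPA.LaurentMod K c))
        (LPA.indGr K c.infPow (LPA.shift (LPA.LaurentMod.gr K c) m))
        (LPA.indAct K c'.infPow (LPA.LaurentMod K c'))
        (LPA.indGr K c'.infPow (LPA.shift (LPA.LaurentMod.gr K c') m')) →
      c = c' ∧ m = m') ∧
    -- every graded simple module induced from the isotropy group of a rational path is in the list
    (∀ x : LPA.BPath G, LPA.IsRational x →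
      ∀ (N : Type*) [AddCommGroup N] [Module K N] [Module (LPA.IsoAlg K x) N]
        [IsScalarTower K (LPA.IsoAlg K x) N] (gr : ℤ → Submodule K N),
      LPA.IsGradedIsoModule K x gr →
      LPA.IsGradedSimple (LPA.indAct K x N) (LPA.indGr K x gr) →
      ∃ c ∈ C, ∃ m : ℕ, m < c.length ∧
        LPA.GradedIso (LPA.indAct K x N) (LPA.indGr K x gr)
          (LPA.indAct K c.infPow (LPA.LaurentMod K c))
          (LPA.indGr K c.infPow (LPA.shift (LPA.LaurentMod.gr K c) m))) := by
  classical
  have hrot : ∀ c ∈ C, ∀ c' ∈ C, c.IsRotation c' → c = c' := fun c hc c' hc' h =>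
    (hC c').unique ⟨hc, h⟩ ⟨hc', List.IsRotated.refl _⟩
  refine ⟨fun c _ m _ => ⟨⟨c.toClosedPath, 0, .refl _⟩,
    LPA.LaurentMod.isGradedIsoModule_shift m, ?_⟩, ?_, ?_⟩
  · exact (LPA.KL.isGradedSimple _ m).of_gradedIso (LPA.gradedIso_indLaurent c m).symm
  · intro c hc m hm c' hc' m' hm' h
    have htail := LPA.KL.exists_tailEquiv_of_gradedIso
      (((LPA.gradedIso_indLaurent c m).symm.trans h).trans (LPA.gradedIso_indLaurent c' m'))
    obtain rfl := hrot c hc c' hc' (LPA.SimpleClosedPath.isRotation_of_tailEquiv htail)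
    refine ⟨rfl, ?_⟩
    -- With `c = c'` the tail equivalence is an isotropy element of degree `m' - m`.
    have hdvd : (c.length : ℤ) ∣ m' - m := LPA.length_dvd_deg c ⟨⟨_, _, _, htail⟩, rfl, rfl⟩
    have h0 := Int.eq_zero_of_abs_lt_dvd hdvd (by rw [abs_lt]; omega)
    omega
  · rintro x ⟨d, k, hx⟩ N _ _ _ _ gr - hsimple
    obtain ⟨d', hd'⟩ := d.exists_simple
    obtain ⟨c, ⟨hc, hcd⟩, -⟩ := hC d'
    obtain ⟨k', hk'⟩ := LPA.ClosedPath.exists_tailEquiv_of_isRotated hcd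
    rw [hd'] at hk'
    -- `c` is a rotation of the simple closed path `d'` with `d'^∞ = d^∞`, so `c^∞` is
    -- tail-equivalent to `x`.
    obtain ⟨e, he⟩ := LPA.exists_gradedIso_KL hsimple (hk'.trans hx.symm)
    have hpos : (0 : ℤ) < c.length := by exact_mod_cast List.length_pos_of_ne_nil c.ne_nil
    have hlt := Int.emod_lt_of_pos e hpos
    have hnonneg := Int.emod_nonneg e hpos.ne'
    refine ⟨c, hc, (e % c.length).toNat, by omega, ?_⟩
    -- The isotropy element of degree `-(e / |c|) |c|` replaces the shift `e` by its residue modulo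
    -- `|c|`.
    have hiso := he _ (c.tailEquiv_infPow_mul_length (-(e / c.length)))
    rw [show e + -(e / c.length) * c.length = ((e % c.length).toNat : ℤ) by
      rw [Int.toNat_of_nonneg hnonneg, Int.emod_def]
      ring] at hiso
    exact hiso.trans (LPA.gradedIso_indLaurent c _).symm
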